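/- Let $K\ge 2$, $N\ge 1$, $M\ge KN$, $T_c\ge 1$ be integers, $\gamma\in[0,1]$ and $d_M\in\mathbb R$. Consider the $K$-user MIMO broadcast channel with a parallel multicast channel. A transmitter with $M$ antennas serves $K$ users with $N$ antennas each; in channel use $t$ user $k$ receives $y_k[t]=H_k[t]x[t]+z_k[t]$, where the noise $z_k[t]$ is i.i.d. $\mathcal{CN}(0,I)$ and $x[t]$ is subject to the average power constraint $P$. The channel matrices are constant over coherence blocks of $T_c$ channel uses, with entries i.i.d. $\mathcal{CN}(0,1)$ across blocks, users and antennas. The receivers know all channel realizations. The transmitter knows the channels of all past blocks, and those of the current block only after $\gamma T_c$ channel uses of that block. In addition, the transmitter can multicast $r_M=d_M\log_2 P$ bits per channel use noiselessly to all users, again as a causal function of the messages and of the channel knowledge it has. User $k$ decodes its own message (the messages are independent and uniform) from $y_k$, the multicast symbols and the channel realizations. A rate tuple is achievable at power $P$ if the error probability can be made arbitrarily small as the code length tends to infinity. The DoF region is the set of tuples $(d_1,\dots,d_K)$ with $d_k=\lim_{P\to\infty}R_k(P)/\log_2P$ for rate tuples $R(P)$ achievable at power $P$, and $d_{\rm sum}$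 is the supremum of $d_1+\dots+d_K$ over this region. Put $$f_p(L,d_M)=\frac{K^2d_M+K^2NL+KNL(K-L)(1-\gamma)}{KL+L(K-L)},\qquad f_q(L)=\frac{N\gamma L(L-1)}{2K-2L+1},$$ $$f_a(L,d_M)=\frac{K(K-L+2)(K-L+1)d_M+KN\gamma(K+1)(K-L+1)}{(K-L+2)L+(K+1)(K-L+1)\sum_{k=1}^{K-L}\frac1k}+KN(1-\gamma).$$ Then $$d_{\rm sum}\le\begin{cases}\min\{f_p(K,d_M),f_a(1,d_M)\}&\text{if } f_q(K)\le d_M,\\ \min\{f_p(L,d_M),f_a(1,d_M)\}&\text{if } f_q(L)\le d_M\le f_q(L+1),\quad L=1,\dots,K-1.\end{cases}$$ Moreover $f_q(K)=K(K-1)N\gamma$; if $d_M\ge f_q(K)$, then $\min\{f_p(K,d_M),f_a(1,d_M)\}=f_p(K,d_M)=KN+d_M$; and if $d_M\ge f_q(1)=0$, then $\min\{f_p(1,d_M),f_a(1,d_M)\}=f_a(1,d_M)=\dfrac{Kd_M+KN\gamma}{\sum_{k=1}^K\frac1k}+KN(1-\gamma)$. -/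

import Mathlib

open MeasureTheory ProbabilityTheory Filter Topology
open scoped ENNReal

namespace MimoBC

noncomputable section

/-- The circularly symmetric complex Gaussian law `CN(0,1)`: independent real and imaginary
parts, each centred with variance `1/2`. -/
def complexGaussian : Measure ℂ :=
  ((gaussianReal 0 (1 / 2)).prod (gaussianReal 0 (1 / 2))).map Complex.measurableEquivRealProd.symm

/-- The number of coherence blocks of length `Tc` that meet the times `0, …, n - 1`
(the last block may be incomplete). -/
def numBlocks (n Tc : ℕ) : ℕ := n ⌈/⌉ Tc

/-- The coherence block that contains time `t`. -/
def blockOf {n Tc : ℕ} (hT : 1 ≤ Tc) (t : Fin n) : Fin (numBlocks n Tc) :=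
  ⟨t.1 / Tc, by
    have h1 : t.1 < n := t.2
    have h2 : n ≤ Tc * numBlocks n Tc := by
      simpa [numBlocks, smul_eq_mul] using le_smul_ceilDiv (a := Tc) (b := n) (by omega)
    exact Nat.div_lt_of_lt_mul (lt_of_lt_of_le h1 h2)⟩

/-- Message tuples `(W_1, …, W_K)`, where `W_k` takes `m k` values. -/
abbrev Messages {K : ℕ} (m : Fin K → ℕ) : Type := (k : Fin K) → Fin (m k)

/-- Channel realisations: `H b k i j` is the coefficient, in coherence block `b`, from transmit
antenna `j` to receive antenna `i` of user `k`. -/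
abbrev Fading (K M N Tc n : ℕ) : Type := Fin (numBlocks n Tc) → Fin K → Fin N → Fin M → ℂ

/-- Noise realisations: `z t k i` is the noise at time `t` on receive antenna `i` of user `k`. -/
abbrev Noise (K N n : ℕ) : Type := Fin n → Fin K → Fin N → ℂ

/-- All messages are independent and uniform. -/
def messageLaw {K : ℕ} (m : Fin K → ℕ) : Measure (Messages m) := uniformOn Set.univ

/-- All channel coefficients are i.i.d. `CN(0,1)`, across blocks, users and antennas. -/
def fadingLaw (K M N Tc n : ℕ) : Measure (Fading K M N Tc n) :=
  Measure.pi fun _ => Measure.pi fun _ => Measure.pi fun _ => Measure.pi fun _ => complexGaussian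

/-- All noise samples are i.i.d. `CN(0,1)`. -/
def noiseLaw (K N n : ℕ) : Measure (Noise K N n) :=
  Measure.pi fun _ => Measure.pi fun _ => Measure.pi fun _ => complexGaussian

/-- The joint law of messages, fading and noise, which are independent. -/
def jointLaw {K : ℕ} (M N Tc n : ℕ) (m : Fin K → ℕ) :
    Measure (Messages m × Fading K M N Tc n × Noise K N n) :=
  (messageLaw m).prod ((fadingLaw K M N Tc n).prod (noiseLaw K N n))

/-- At time `t` the transmitter knows the coefficients of block `b` exactly when `b` is a past
block, or `b` is the current block and at least `γ * Tc` channel uses of it have elapsed. -/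
def CSITKnown (Tc : ℕ) (γ : ℝ) {n : ℕ} (t : Fin n) (b : Fin (numBlocks n Tc)) : Prop :=
  b.1 < t.1 / Tc ∨ (b.1 = t.1 / Tc ∧ γ * (Tc : ℝ) ≤ ((t.1 % Tc : ℕ) : ℝ))

/-- A code of length `n` with `m k` messages for user `k`. In channel use `t` the transmitter
sends `x t` over the MIMO BC and the symbol `y₀ t` over the noiseless multicast channel, both as
functions of the messages and of the channel coefficients known to it at time `t`. User `k`
decodes from its received signal, the multicast symbols and all channel realisations. -/
structure Code (K M N Tc : ℕ) (γ : ℝ) (n : ℕ) (m : Fin K → ℕ) where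
  x : Fin n → Messages m → Fading K M N Tc n → Fin M → ℂ
  /-- size of the multicast alphabet in each channel use -/
  q : Fin n → ℕ
  y₀ : (t : Fin n) → Messages m → Fading K M N Tc n → Fin (q t)
  dec : (k : Fin K) →
    (Fin n → Fin N → ℂ) × ((t : Fin n) → Fin (q t)) × Fading K M N Tc n → Fin (m k)
  measurable_x : ∀ t w, Measurable (x t w)
  measurable_y₀ : ∀ t w, Measurable (y₀ t w)
  measurable_dec : ∀ k, Measurable (dec k)
  causal_x : ∀ t w H H', (∀ b, CSITKnown Tc γ t b → H b = H' b) → x t w H = x t w H'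
  causal_y₀ : ∀ t w H H', (∀ b, CSITKnown Tc γ t b → H b = H' b) → y₀ t w H = y₀ t w H'

variable {K M N Tc : ℕ} {γ : ℝ} {n : ℕ} {m : Fin K → ℕ}

/-- The signal `y_k[t] = H_k[t] x[t] + z_k[t]` received by user `k` over the MIMO BC. -/
def Code.received (c : Code K M N Tc γ n m) (hT : 1 ≤ Tc) (w : Messages m)
    (H : Fading K M N Tc n) (z : Noise K N n) (k : Fin K) : Fin n → Fin N → ℂ :=
  fun t i => (∑ j, H (blockOf hT t) k i j * c.x t w H j) + z t k i

/-- The message of user `k` as decoded by that user. -/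
def Code.decoded (c : Code K M N Tc γ n m) (hT : 1 ≤ Tc) (w : Messages m)
    (H : Fading K M N Tc n) (z : Noise K N n) (k : Fin K) : Fin (m k) :=
  c.dec k (c.received hT w H z k, fun t => c.y₀ t w H, H)

/-- The probability that some user decodes its message wrongly. -/
def Code.errorProb (c : Code K M N Tc γ n m) (hT : 1 ≤ Tc) : ℝ≥0∞ :=
  jointLaw M N Tc n m {ω | ∃ k, c.decoded hT ω.1 ω.2.1 ω.2.2 k ≠ ω.1 k}

/-- The average power constraint `(1/n) ∑ₜ E ‖x[t]‖² ≤ P`. -/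
def Code.PowerConstraint (c : Code K M N Tc γ n m) (P : ℝ) : Prop :=
  ∑ t, ∫⁻ ω, ∑ j, ‖c.x t ω.1 ω.2 j‖ₑ ^ 2 ∂((messageLaw m).prod (fadingLaw K M N Tc n))
    ≤ ENNReal.ofReal (n * P)

/-- The multicast channel carries at most `rM` bits per channel use, i.e. `n * rM` bits in
total. -/
def Code.MulticastConstraint (c : Code K M N Tc γ n m) (rM : ℝ) : Prop :=
  ((∏ t, c.q t : ℕ) : ℝ) ≤ (2 : ℝ) ^ (n * rM)

/-- Achievability of the rate tuple `R` (bits per channel use) under power constraint `P` and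
multicast rate `rM`: for all large `n` there are codes of length `n` with `⌈2 ^ (n R_k)⌉` messages
for user `k` whose error probability is arbitrarily small. -/
def Achievable (K M N : ℕ) {Tc : ℕ} (hT : 1 ≤ Tc) (γ P rM : ℝ) (R : Fin K → ℝ) : Prop :=
  (∀ k, 0 ≤ R k) ∧
  ∀ ε : ℝ≥0∞, 0 < ε → ∀ᶠ n : ℕ in atTop,
    ∃ c : Code K M N Tc γ n (fun k => ⌈(2 : ℝ) ^ (n * R k)⌉₊),
      c.PowerConstraint P ∧ c.MulticastConstraint rM ∧ c.errorProb hT ≤ ε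

/-- The DoF region for multicast rate `rM = dM log₂ P`: all limits `d_k = lim R_k(P) / log₂ P`
along achievable rate tuples `R(P)`. -/
def dofRegion (K M N : ℕ) {Tc : ℕ} (hT : 1 ≤ Tc) (γ dM : ℝ) : Set (Fin K → ℝ) :=
  {d | ∃ R : ℝ → Fin K → ℝ,
    (∀ᶠ P in atTop, Achievable K M N hT γ P (dM * Real.logb 2 P) (R P)) ∧
    ∀ k, Tendsto (fun P => R P k / Real.logb 2 P) atTop (𝓝 (d k))}

/-- The sum DoF, as an extended real number. -/
def sumDoF (K M N : ℕ) {Tc : ℕ} (hT : 1 ≤ Tc) (γ dM : ℝ) : EReal :=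
  sSup ((fun d : Fin K → ℝ => ((∑ k, d k : ℝ) : EReal)) '' dofRegion K M N hT γ dM)

def fp (K N : ℕ) (γ : ℝ) (L : ℕ) (dM : ℝ) : ℝ :=
  ((K : ℝ) ^ 2 * dM + (K : ℝ) ^ 2 * N * L + (K : ℝ) * N * L * ((K : ℝ) - L) * (1 - γ)) /
    ((K : ℝ) * L + L * ((K : ℝ) - L))

def fq (K N : ℕ) (γ : ℝ) (L : ℕ) : ℝ :=
  (N : ℝ) * γ * L * ((L : ℝ) - 1) / (2 * (K : ℝ) - 2 * L + 1)

def fa (K N : ℕ) (γ : ℝ) (L : ℕ) (dM : ℝ) : ℝ :=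
  ((K : ℝ) * ((K : ℝ) - L + 2) * ((K : ℝ) - L + 1) * dM
      + (K : ℝ) * N * γ * ((K : ℝ) + 1) * ((K : ℝ) - L + 1)) /
    (((K : ℝ) - L + 2) * L
      + ((K : ℝ) + 1) * ((K : ℝ) - L + 1) * ∑ k ∈ Finset.Icc 1 (K - L), 1 / (k : ℝ))
    + (K : ℝ) * N * (1 - γ)

end

end MimoBC

/-! The converse compares how much different groups of users learn. Fix a code and let `Code.ent` be
the conditional entropy of the message tuple given the fading and a set of observations: messages,
multicast symbols, received samples. Given messages and fading, the observations are independent, so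
an observation becomes less informative as the conditioning grows (`Code.ent_submod`). The messages
range over a finite set, so no differential entropy occurs; every estimate is Gibbs' inequality
against a suitable test density (`equivoc_le_insert`).

Let S ⊆ T be groups of users and look at one channel use. If the transmitter does not yet know the
current block, permuting the users in that block changes nothing it has sent, so the users of T are
exchangeable and submodularity makes the information per user nonincreasing in the group size:
I_T/|T| ≤ I_S/|S|. If it knows the block, the |T| - |S| extra users add at most N log P + O(1) each,
and this happens in at most a fraction 1 - γ of the channel uses (`sum_informed_le`). Writing I(U;
A) for `Code.info`, summation over time (`Code.info_step`) gives I(U; T)/|T| ≤ I(U; S)/|S| + (|T| -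
|S|)/|T| · N n (1 - γ) log P + O(n).

Now take a chain S₀ ⊆ S₁ ⊆ … ⊆ S_r. By Fano's inequality, the rates of the users in S_{i+1} \ S_i
are bounded by I(S_i; S_{i+1}) - I(S_{i+1}; S_{i+1}), up to a small error (`Code.sum_log_le_info`).
Dividing by |S_{i+1}| and adding up, the terms I(S_i; S_i)/|S_i| cancel. Only I(∅; S₀)/|S₀| remains,
and it is at most the multicast rate over |S₀| plus N log P + O(1) per channel use. Dividing by log
P and letting P tend to infinity yields a half-space containing the DoF region
(`chainSum_le_of_mem_dofRegion`).

Averaging over the K cyclic shifts of the users turns this into a bound on the sum that depends only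
on the group sizes. The sizes L, K give f_p(L), and the sizes 1, 2, …, K give f_a(1). The
comparisons of f_p with f_a reduce to 2 - 1/K ≤ ∑_{k ≤ K} 1/k ≤ K - 1 + 1/K. -/

open scoped NNReal

namespace MimoBC

noncomputable section

set_option linter.unusedSectionVars false

/-! ### Conditional entropy of a finite input given conditionally independent observations. -/

section Equivocation

variable {W J α : Type*} [Fintype J] [DecidableEq J] [MeasurableSpace α]

/-- The likelihood of the input `w` given the observations in `X`: each observation `j` has
density `p w j` with respect to a reference measure. -/
def lik (p : W → J → α → ℝ≥0) (X : Finset J) (w : W) (y : J → α) : ℝ≥0 := ∏ j ∈ X, p w j (y j)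

/-- The total likelihood of the observations in `X`. -/
def tot [Fintype W] (p : W → J → α → ℝ≥0) (X : Finset J) (y : J → α) : ℝ≥0 := ∑ w, lik p X w y

/-- The expectation, summed over the inputs `w`, of `F w` of the observations in `X`. -/
def expect [Fintype W] (ν : J → Measure α) (p : W → J → α → ℝ≥0) (X : Finset J)
    (F : W → (J → α) → ℝ) : ℝ≥0∞ :=
  ∑ w, ∫⁻ y, lik p X w y * ENNReal.ofReal (F w y) ∂Measure.pi ν

/-- `|W|` times the conditional entropy of a uniform input `w` given the observations in `X`. -/
def equivoc [Fintype W] (ν : J → Measure α) (p : W → J → α → ℝ≥0) (X : Finset J) : ℝ≥0∞ :=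
  expect ν p X fun w y => Real.log (tot p X y / lik p X w y)

/-- Resampling one coordinate of a product of probability measures leaves the integral unchanged.
This allows single observations to be integrated out. -/
lemma lintegral_pi_update (ν : J → Measure α) [∀ j, IsProbabilityMeasure (ν j)] (j : J)
    {f : (J → α) → ℝ≥0∞} (hf : Measurable f) :
    ∫⁻ y, f y ∂Measure.pi ν = ∫⁻ y, ∫⁻ a, f (Function.update y j a) ∂ν j ∂Measure.pi ν := by
  have hg : Measurable (∫⋯∫⁻_{j}, f ∂ν) := hf.lmarginal ν
  have h : ∫⋯∫⁻_{j}, (∫⋯∫⁻_{j}, f ∂ν) ∂ν = ∫⋯∫⁻_{j}, f ∂ν := by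
    funext y
    rw [lmarginal_singleton]
    simp [lmarginal_update_of_mem (μ := ν) (Finset.mem_singleton_self j) f]
  have key : ∫⁻ y, f y ∂Measure.pi ν = ∫⁻ y, (∫⋯∫⁻_{j}, f ∂ν) y ∂Measure.pi ν :=
    lintegral_eq_of_lmarginal_eq {j} hf hg h.symm
  rw [key]
  simp_rw [lmarginal_singleton]

variable {p : W → J → α → ℝ≥0}

@[simp] lemma lik_empty (w : W) (y : J → α) : lik p ∅ w y = 1 := rfl

lemma lik_insert {X : Finset J} {j : J} (hj : j ∉ X) (w : W) (y : J → α) :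
    lik p (insert j X) w y = p w j (y j) * lik p X w y := Finset.prod_insert hj

lemma lik_update {X : Finset J} {j : J} (hj : j ∉ X) (w : W) (y : J → α) (a : α) :
    lik p X w (Function.update y j a) = lik p X w y := by
  refine Finset.prod_congr rfl fun i hi => ?_
  rw [Function.update_of_ne (by rintro rfl; exact hj hi)]

lemma measurable_lik (hp : ∀ w j, Measurable (p w j)) (X : Finset J) (w : W) :
    Measurable (lik p X w) := by
  unfold lik
  exact Finset.measurable_prod _ fun j _ => (hp w j).comp (measurable_pi_apply j)

lemma lik_ne_zero_of_insert {X : Finset J} {j : J} (hj : j ∉ X) {w : W} {y : J → α}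
    (h : lik p (insert j X) w y ≠ 0) : p w j (y j) ≠ 0 ∧ lik p X w y ≠ 0 := by
  rw [lik_insert hj] at h
  exact ⟨left_ne_zero_of_mul h, right_ne_zero_of_mul h⟩

lemma lik_ne_zero_of_subset {X Z : Finset J} (hXZ : X ⊆ Z) {w : W} {y : J → α}
    (h : lik p Z w y ≠ 0) : lik p X w y ≠ 0 := by
  unfold lik at *
  rw [Finset.prod_ne_zero_iff] at *
  exact fun a ha => h a (hXZ ha)

variable {ν : J → Measure α} [∀ j, IsProbabilityMeasure (ν j)]

lemma lintegral_lik_insert (hp : ∀ w j, Measurable (p w j)) (hp1 : ∀ w j, ∫⁻ a, p w j a ∂ν j = 1)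
    {X : Finset J} {j : J} (hj : j ∉ X) (w : W) {F : (J → α) → ℝ≥0∞} (hF : Measurable F)
    (hFj : ∀ y a, F (Function.update y j a) = F y) :
    ∫⁻ y, lik p (insert j X) w y * F y ∂Measure.pi ν = ∫⁻ y, lik p X w y * F y ∂Measure.pi ν := by
  have hm : Measurable fun y => (lik p (insert j X) w y : ℝ≥0∞) * F y :=
    (measurable_lik hp _ w).coe_nnreal_ennreal.mul hF
  rw [lintegral_pi_update ν j hm]
  refine lintegral_congr fun y => ?_
  simp_rw [hFj, lik_insert hj, lik_update hj, Function.update_self, ENNReal.coe_mul, mul_assoc]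
  rw [lintegral_mul_const _ (hp w j).coe_nnreal_ennreal, hp1, one_mul]

/-- Each density integrates to one, so observations on which the integrand does not depend drop out.
Equivocations given different sets can thus be compared under a single integral. -/
lemma lintegral_lik_subset (hp : ∀ w j, Measurable (p w j)) (hp1 : ∀ w j, ∫⁻ a, p w j a ∂ν j = 1)
    {X Z : Finset J} (hXZ : X ⊆ Z) (w : W) {F : (J → α) → ℝ≥0∞} (hF : Measurable F)
    (hFX : ∀ j ∉ X, ∀ y a, F (Function.update y j a) = F y) :
    ∫⁻ y, lik p Z w y * F y ∂Measure.pi ν = ∫⁻ y, lik p X w y * F y ∂Measure.pi ν := by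
  suffices h : ∀ A : Finset J, ∫⁻ y, lik p (X ∪ A) w y * F y ∂Measure.pi ν
      = ∫⁻ y, lik p X w y * F y ∂Measure.pi ν by
    simpa [Finset.union_eq_right.2 hXZ] using h Z
  intro A
  induction A using Finset.induction_on with
  | empty => simp
  | insert j A _ ih =>
    rw [Finset.union_insert]
    by_cases hj : j ∈ X ∪ A
    · rw [Finset.insert_eq_of_mem hj, ih]
    · rw [lintegral_lik_insert hp hp1 hj w hF (hFX j fun h => hj (Finset.mem_union_left _ h)), ih]

lemma lintegral_lik (hp : ∀ w j, Measurable (p w j)) (hp1 : ∀ w j, ∫⁻ a, p w j a ∂ν j = 1)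
    (X : Finset J) (w : W) : ∫⁻ y, lik p X w y ∂Measure.pi ν = 1 := by
  have := lintegral_lik_subset hp hp1 (Finset.empty_subset X) w (F := fun _ => 1)
    measurable_const (fun _ _ _ _ => rfl)
  simpa using this

variable [Fintype W]

lemma tot_update {X : Finset J} {j : J} (hj : j ∉ X) (y : J → α) (a : α) :
    tot p X (Function.update y j a) = tot p X y := by
  simp [tot, lik_update hj]

lemma measurable_tot (hp : ∀ w j, Measurable (p w j)) (X : Finset J) : Measurable (tot p X) := by
  unfold tot
  exact Finset.measurable_sum _ fun w _ => measurable_lik hp X w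

lemma lik_le_tot (X : Finset J) (w : W) (y : J → α) : lik p X w y ≤ tot p X y :=
  Finset.single_le_sum (f := fun w => lik p X w y) (fun _ _ => zero_le) (Finset.mem_univ w)

lemma lintegral_tot (hp : ∀ w j, Measurable (p w j)) (hp1 : ∀ w j, ∫⁻ a, p w j a ∂ν j = 1)
    (X : Finset J) : ∫⁻ y, tot p X y ∂Measure.pi ν = Fintype.card W := by
  simp only [tot, ENNReal.ofNNReal_finsetSum]
  rw [lintegral_finsetSum _ fun w _ => (measurable_lik hp X w).coe_nnreal_ennreal]
  simp [lintegral_lik hp hp1]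

lemma log_tot_div_nonneg (X : Finset J) (w : W) (y : J → α) :
    0 ≤ Real.log (tot p X y / lik p X w y) := by
  rcases eq_or_ne (lik p X w y) 0 with h | h
  · simp [h]
  · apply Real.log_nonneg
    rw [one_le_div (by positivity)]
    exact_mod_cast lik_le_tot X w y

lemma expect_subset (hp : ∀ w j, Measurable (p w j)) (hp1 : ∀ w j, ∫⁻ a, p w j a ∂ν j = 1)
    {X Z : Finset J} (hXZ : X ⊆ Z) {F : W → (J → α) → ℝ} (hF : ∀ w, Measurable (F w))
    (hFX : ∀ w, ∀ j ∉ X, ∀ y a, F w (Function.update y j a) = F w y) :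
    expect ν p Z F = expect ν p X F :=
  Finset.sum_congr rfl fun w _ => lintegral_lik_subset hp hp1 hXZ w (hF w).ennreal_ofReal
    fun j hj y a => by rw [hFX w j hj]

lemma measurable_log_tot_div (hp : ∀ w j, Measurable (p w j)) (X : Finset J) (w : W) :
    Measurable fun y => Real.log (tot p X y / lik p X w y) :=
  Real.measurable_log.comp
    ((measurable_tot hp X).coe_nnreal_real.div (measurable_lik hp X w).coe_nnreal_real)

lemma equivoc_eq_expect (hp : ∀ w j, Measurable (p w j)) (hp1 : ∀ w j, ∫⁻ a, p w j a ∂ν j = 1)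
    {X Z : Finset J} (hXZ : X ⊆ Z) :
    equivoc ν p X = expect ν p Z fun w y => Real.log (tot p X y / lik p X w y) :=
  (expect_subset hp hp1 hXZ (measurable_log_tot_div hp X)
    fun w j hj y a => by rw [tot_update hj, lik_update hj]).symm

/-- Integrating a pointwise inequality whose error term has total mass at most `|W|`. -/
lemma expect_le_of_pointwise (hp : ∀ w j, Measurable (p w j))
    (hp1 : ∀ w j, ∫⁻ a, p w j a ∂ν j = 1) (X : Finset J) {F G : W → (J → α) → ℝ}
    {z : W → (J → α) → ℝ≥0} (hG : ∀ w, Measurable (G w)) (hz : ∀ w, Measurable (z w))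
    (hF0 : ∀ w y, 0 ≤ F w y) (hG0 : ∀ w y, 0 ≤ G w y)
    (h : ∀ w y, lik p X w y ≠ 0 → F w y + 1 ≤ G w y + z w y)
    (hz1 : ∫⁻ y, ∑ w, (lik p X w y * z w y : ℝ≥0) ∂Measure.pi ν ≤ Fintype.card W) :
    expect ν p X F ≤ expect ν p X G := by
  have hl := fun w => (measurable_lik hp X w).coe_nnreal_ennreal
  -- The total mass |W| of the likelihoods, added to both sides, absorbs the `+ 1` of the pointwise
  -- bound; no subtraction or integrability is needed before the final cancellation.
  have key : expect ν p X F + Fintype.card W ≤ expect ν p X G + Fintype.card W := by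
    calc expect ν p X F + Fintype.card W
        = ∑ w, ∫⁻ y, lik p X w y * ENNReal.ofReal (F w y) + lik p X w y ∂Measure.pi ν := by
          simp_rw [fun w => lintegral_add_right (μ := Measure.pi ν)
            (fun y => lik p X w y * ENNReal.ofReal (F w y)) (hl w), Finset.sum_add_distrib,
            lintegral_lik hp hp1]
          simp [expect]
      _ ≤ ∑ w, ∫⁻ y, lik p X w y * ENNReal.ofReal (G w y) + (lik p X w y * z w y : ℝ≥0)
            ∂Measure.pi ν := by
          refine Finset.sum_le_sum fun w _ => lintegral_mono fun y => ?_
          rcases eq_or_ne (lik p X w y) 0 with h0 | h0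
          · simp [h0]
          · have h1 : ENNReal.ofReal (F w y) + 1 ≤ ENNReal.ofReal (G w y) + (z w y : ℝ≥0∞) := by
              rw [← ENNReal.ofReal_one, ← ENNReal.ofReal_add (hF0 w y) zero_le_one,
                ← ENNReal.ofReal_coe_nnreal (p := z w y), ← ENNReal.ofReal_add (hG0 w y) NNReal.zero_le_coe]
              exact ENNReal.ofReal_le_ofReal (h w y h0)
            calc (lik p X w y : ℝ≥0∞) * ENNReal.ofReal (F w y) + lik p X w y
                = lik p X w y * (ENNReal.ofReal (F w y) + 1) := by ring
              _ ≤ lik p X w y * (ENNReal.ofReal (G w y) + (z w y : ℝ≥0∞)) := by gcongr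
              _ = _ := by push_cast; ring
      _ = expect ν p X G + ∫⁻ y, ∑ w, (lik p X w y * z w y : ℝ≥0) ∂Measure.pi ν := by
          have hm : ∀ w, Measurable fun y => ((lik p X w y * z w y : ℝ≥0) : ℝ≥0∞) := fun w =>
            ((measurable_lik hp X w).mul (hz w)).coe_nnreal_ennreal
          rw [lintegral_finsetSum _ fun w _ => hm w, expect, ← Finset.sum_add_distrib]
          exact Finset.sum_congr rfl fun w _ => lintegral_add_left
            ((hl w).mul (hG w).ennreal_ofReal) _
      _ ≤ _ := by gcongr
  exact (ENNReal.add_le_add_iff_right (by simp)).1 key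

lemma expect_add (hp : ∀ w j, Measurable (p w j)) (X : Finset J) {F G : W → (J → α) → ℝ}
    (hF : ∀ w, Measurable (F w)) (hF0 : ∀ w y, 0 ≤ F w y) (hG0 : ∀ w y, 0 ≤ G w y) :
    expect ν p X (fun w y => F w y + G w y) = expect ν p X F + expect ν p X G := by
  rw [expect, expect, expect, ← Finset.sum_add_distrib]
  refine Finset.sum_congr rfl fun w _ => ?_
  have hm : Measurable fun y => (lik p X w y : ℝ≥0∞) * ENNReal.ofReal (F w y) :=
    (measurable_lik hp X w).coe_nnreal_ennreal.mul (hF w).ennreal_ofReal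
  rw [← lintegral_add_left hm]
  refine lintegral_congr fun y => ?_
  rw [ENNReal.ofReal_add (hF0 w y) (hG0 w y), mul_add]

lemma sum_lik_insert_mul_le {X : Finset J} {j : J} (y : J → α) (q : ℝ≥0) :
    ∑ w, lik p (insert j X) w y * (q / tot p (insert j X) y) ≤ q := by
  rw [← Finset.sum_mul]
  change tot p _ y * _ ≤ q
  rcases eq_or_ne (tot p (insert j X) y) 0 with h | h
  · simp [h]
  · rw [mul_div_cancel₀ _ h]

/-- Comparison of the information carried by the observation `j` with any conditional density
`r` of that observation. -/
lemma equivoc_le_insert (hp : ∀ w j, Measurable (p w j))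
    (hp1 : ∀ w j, ∫⁻ a, p w j a ∂ν j = 1) {X : Finset J} {j : J} (hj : j ∉ X)
    {r : (J → α) → ℝ≥0} (hr : Measurable r)
    (hr1 : ∀ y, ∫⁻ a, r (Function.update y j a) ∂ν j ≤ 1)
    {g g' : W → (J → α) → ℝ} (hg : ∀ w, Measurable (g w)) (hg' : ∀ w, Measurable (g' w))
    (hg0 : ∀ w y, 0 ≤ g w y) (hg0' : ∀ w y, 0 ≤ g' w y)
    (h : ∀ w y, lik p (insert j X) w y ≠ 0 →
      r y ≠ 0 ∧ Real.log (p w j (y j)) + g' w y ≤ Real.log (r y) + g w y) :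
    expect ν p (insert j X) g' + equivoc ν p X
      ≤ expect ν p (insert j X) g + equivoc ν p (insert j X) := by
  rw [equivoc_eq_expect hp hp1 (Finset.subset_insert j X), equivoc,
    ← expect_add hp _ hg' hg0' (log_tot_div_nonneg _), ← expect_add hp _ hg hg0
      (log_tot_div_nonneg _)]
  -- `z` is the quotient of `r` by the true predictive density of observation `j` given `X`; the
  -- bound log z ≤ z - 1 is Gibbs' inequality.
  refine expect_le_of_pointwise hp hp1 _
    (z := fun _ y => tot p X y * r y / tot p (insert j X) y)
    (fun w => (hg w).add (measurable_log_tot_div hp _ w))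
    (fun w => ((measurable_tot hp X).mul hr).div (measurable_tot hp _))
    (fun w y => add_nonneg (hg0' w y) (log_tot_div_nonneg _ w y))
    (fun w y => add_nonneg (hg0 w y) (log_tot_div_nonneg _ w y)) ?_ ?_
  · intro w y hl
    obtain ⟨hr0, hle⟩ := h w y hl
    obtain ⟨hpj, hX⟩ := lik_ne_zero_of_insert hj hl
    have hT : (tot p X y : ℝ) ≠ 0 := by
      exact_mod_cast (lt_of_lt_of_le (pos_iff_ne_zero.2 hX) (lik_le_tot X w y)).ne'
    have hT' : (tot p (insert j X) y : ℝ) ≠ 0 := by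
      exact_mod_cast (lt_of_lt_of_le (pos_iff_ne_zero.2 hl) (lik_le_tot _ w y)).ne'
    have hr0' : (r y : ℝ) ≠ 0 := by exact_mod_cast hr0
    have hpj' : (p w j (y j) : ℝ) ≠ 0 := by exact_mod_cast hpj
    have hX' : (lik p X w y : ℝ) ≠ 0 := by exact_mod_cast hX
    have hlog : Real.log (tot p X y * r y / tot p (insert j X) y)
        ≤ tot p X y * r y / tot p (insert j X) y - 1 :=
      Real.log_le_sub_one_of_pos (by positivity)
    rw [Real.log_div (by positivity) hT', Real.log_mul hT hr0'] at hlog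
    rw [lik_insert hj]
    push_cast
    rw [Real.log_div hT hX', Real.log_div hT' (by positivity), Real.log_mul hpj' hX']
    linarith
  · calc ∫⁻ y, ∑ w, (lik p (insert j X) w y * (tot p X y * r y / tot p (insert j X) y) : ℝ≥0)
          ∂Measure.pi ν
        ≤ ∫⁻ y, (tot p X y * r y : ℝ≥0) ∂Measure.pi ν := by
          refine lintegral_mono fun y => ?_
          rw [← ENNReal.ofNNReal_finsetSum]
          refine ENNReal.coe_le_coe.2 ?_
          exact sum_lik_insert_mul_le y _
      _ ≤ ∫⁻ y, tot p X y ∂Measure.pi ν := by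
          have hm : Measurable fun y => ((tot p X y * r y : ℝ≥0) : ℝ≥0∞) :=
            ((measurable_tot hp X).mul hr).coe_nnreal_ennreal
          rw [lintegral_pi_update ν j hm]
          refine lintegral_mono fun y => ?_
          simp_rw [tot_update hj, ENNReal.coe_mul]
          rw [lintegral_const_mul' _ _ (by simp)]
          exact mul_le_of_le_one_right' (hr1 y)
      _ = _ := lintegral_tot hp hp1 X

/-- Gibbs' inequality between the posteriors of the input with and without the new observation. -/
lemma equivoc_insert_le (hp : ∀ w j, Measurable (p w j))
    (hp1 : ∀ w j, ∫⁻ a, p w j a ∂ν j = 1) (X : Finset J) (j : J) :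
    equivoc ν p (insert j X) ≤ equivoc ν p X := by
  by_cases hj : j ∈ X
  · rw [Finset.insert_eq_of_mem hj]
  rw [equivoc_eq_expect hp hp1 (Finset.subset_insert j X), equivoc]
  -- `z` is the posterior of `w` given `X` divided by its posterior given `insert j X`.
  refine expect_le_of_pointwise hp hp1 _
    (z := fun w y => tot p (insert j X) y / (p w j (y j) * tot p X y))
    (measurable_log_tot_div hp _)
    (fun w => (measurable_tot hp _).div (((hp w j).comp (measurable_pi_apply j)).mul
      (measurable_tot hp X)))
    (log_tot_div_nonneg _) (log_tot_div_nonneg _) ?_ ?_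
  · intro w y hl
    obtain ⟨hpj, hX⟩ := lik_ne_zero_of_insert hj hl
    have hT : (tot p X y : ℝ) ≠ 0 := by
      exact_mod_cast (lt_of_lt_of_le (pos_iff_ne_zero.2 hX) (lik_le_tot X w y)).ne'
    have hT' : (tot p (insert j X) y : ℝ) ≠ 0 := by
      exact_mod_cast (lt_of_lt_of_le (pos_iff_ne_zero.2 hl) (lik_le_tot _ w y)).ne'
    have hpj' : (p w j (y j) : ℝ) ≠ 0 := by exact_mod_cast hpj
    have hX' : (lik p X w y : ℝ) ≠ 0 := by exact_mod_cast hX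
    have hlog : Real.log (tot p (insert j X) y / (p w j (y j) * tot p X y))
        ≤ tot p (insert j X) y / (p w j (y j) * tot p X y) - 1 :=
      Real.log_le_sub_one_of_pos (by positivity)
    rw [Real.log_div hT' (by positivity), Real.log_mul hpj' hT] at hlog
    rw [lik_insert hj]
    push_cast
    rw [Real.log_div hT hX', Real.log_div hT' (by positivity), Real.log_mul hpj' hX']
    linarith
  · rw [← lintegral_tot hp hp1 (insert j X)]
    refine lintegral_mono fun y => ?_
    rw [← ENNReal.ofNNReal_finsetSum]
    refine ENNReal.coe_le_coe.2 ?_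
    calc ∑ w, lik p (insert j X) w y * (tot p (insert j X) y / (p w j (y j) * tot p X y))
        ≤ ∑ w, lik p X w y * (tot p (insert j X) y / tot p X y) := by
          refine Finset.sum_le_sum fun w _ => ?_
          rw [lik_insert hj]
          rcases eq_or_ne (p w j (y j)) 0 with h0 | h0
          · simp [h0]
          · rw [← div_div, div_right_comm, mul_right_comm, mul_div_cancel₀ _ h0, mul_comm]
      _ = tot p X y * (tot p (insert j X) y / tot p X y) := by rw [← Finset.sum_mul]; rfl
      _ ≤ _ := by
          rcases eq_or_ne (tot p X y) 0 with h | h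
          · simp [h]
          · rw [mul_div_cancel₀ _ h]

lemma equivoc_anti (hp : ∀ w j, Measurable (p w j)) (hp1 : ∀ w j, ∫⁻ a, p w j a ∂ν j = 1)
    {X Z : Finset J} (hXZ : X ⊆ Z) : equivoc ν p Z ≤ equivoc ν p X := by
  suffices h : ∀ A : Finset J, equivoc ν p (X ∪ A) ≤ equivoc ν p X by
    simpa [Finset.union_eq_right.2 hXZ] using h Z
  intro A
  induction A using Finset.induction_on with
  | empty => simp
  | insert j A _ ih =>
    rw [Finset.union_insert]
    exact (equivoc_insert_le hp hp1 _ j).trans ih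

/-- Conditioning on more observations makes a further observation less informative. -/
lemma equivoc_add_insert_le (hp : ∀ w j, Measurable (p w j))
    (hp1 : ∀ w j, ∫⁻ a, p w j a ∂ν j = 1) {X Z : Finset J} (hZX : Z ⊆ X) (j : J) :
    equivoc ν p (insert j Z) + equivoc ν p X ≤ equivoc ν p Z + equivoc ν p (insert j X) := by
  by_cases hj : j ∈ X
  · rw [Finset.insert_eq_of_mem hj]
    gcongr
    exact equivoc_insert_le hp hp1 Z j
  have hjZ : j ∉ Z := fun h => hj (hZX h)
  rw [equivoc_eq_expect hp hp1 (Finset.insert_subset_insert j hZX),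
    equivoc_eq_expect hp hp1 (hZX.trans (Finset.subset_insert j X))]
  -- The test density is the predictive density of observation `j` given the smaller set `Z`.
  -- Conditional independence makes the density of `j` given `w` the same for both sets, so the
  -- pointwise condition holds with equality.
  refine equivoc_le_insert hp hp1 hj (r := fun y => tot p (insert j Z) y / tot p Z y)
    ((measurable_tot hp _).div (measurable_tot hp _)) ?_
    (measurable_log_tot_div hp _) (measurable_log_tot_div hp _) (log_tot_div_nonneg _)
    (log_tot_div_nonneg _) ?_
  · intro y
    have h1 : ∫⁻ a, (tot p (insert j Z) (Function.update y j a) : ℝ≥0∞) ∂ν j = tot p Z y := by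
      simp only [tot, lik_insert hjZ, lik_update hjZ, Function.update_self, ENNReal.ofNNReal_finsetSum,
        ENNReal.coe_mul]
      rw [lintegral_finsetSum _ fun w _ => (hp w j).coe_nnreal_ennreal.mul_const _]
      simp_rw [fun w => lintegral_mul_const (μ := ν j) (lik p Z w y : ℝ≥0∞)
        (hp w j).coe_nnreal_ennreal, hp1, one_mul]
    rcases eq_or_ne (tot p Z y) 0 with h0 | h0
    · simp [tot_update hjZ, h0]
    · simp_rw [tot_update hjZ, ENNReal.coe_div h0, div_eq_mul_inv]
      rw [lintegral_mul_const' _ _ (by simpa using h0), h1,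
        ENNReal.mul_inv_cancel (by simpa using h0) (by simp)]
  · intro w y hl
    have hlZ := lik_ne_zero_of_subset (Finset.insert_subset_insert j hZX) hl
    obtain ⟨hpj, hX⟩ := lik_ne_zero_of_insert hjZ hlZ
    have hT : tot p Z y ≠ 0 := (lt_of_lt_of_le (pos_iff_ne_zero.2 hX) (lik_le_tot Z w y)).ne'
    have hT' : tot p (insert j Z) y ≠ 0 :=
      (lt_of_lt_of_le (pos_iff_ne_zero.2 hlZ) (lik_le_tot _ w y)).ne'
    refine ⟨div_ne_zero hT' hT, le_of_eq ?_⟩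
    rw [lik_insert hjZ]
    have hTr : (tot p Z y : ℝ) ≠ 0 := by exact_mod_cast hT
    have hTr' : (tot p (insert j Z) y : ℝ) ≠ 0 := by exact_mod_cast hT'
    have hpj' : (p w j (y j) : ℝ) ≠ 0 := by exact_mod_cast hpj
    have hX' : (lik p Z w y : ℝ) ≠ 0 := by exact_mod_cast hX
    push_cast
    rw [Real.log_div hTr hX', Real.log_div hTr' (by positivity), Real.log_mul hpj' hX',
      Real.log_div hTr' hTr]
    ring

lemma equivoc_empty : equivoc ν p ∅ = Fintype.card W * ENNReal.ofReal (Real.log (Fintype.card W)) := by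
  simp [equivoc, expect, tot]

lemma equivoc_le (hp : ∀ w j, Measurable (p w j)) (hp1 : ∀ w j, ∫⁻ a, p w j a ∂ν j = 1)
    (X : Finset J) : equivoc ν p X ≤ Fintype.card W * ENNReal.ofReal (Real.log (Fintype.card W)) :=
  (equivoc_anti hp hp1 (Finset.empty_subset X)).trans_eq equivoc_empty

/-- The equivocation vanishes if the observations determine the input. -/
lemma equivoc_eq_zero {X : Finset J}
    (h : ∀ w w' y, lik p X w y ≠ 0 → w' ≠ w → lik p X w' y = 0) : equivoc ν p X = 0 := by
  refine Finset.sum_eq_zero fun w _ => ?_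
  rw [← lintegral_zero (μ := Measure.pi ν)]
  refine lintegral_congr fun y => ?_
  rcases eq_or_ne (lik p X w y) 0 with h0 | h0
  · simp [h0]
  · have : tot p X y = lik p X w y :=
      Finset.sum_eq_single w (fun w' _ hw => h w w' y h0 hw) (by simp)
    have h0' : (lik p X w y : ℝ) ≠ 0 := by exact_mod_cast h0
    simp [this, h0']

/-- Relabelling observations with the same reference measures. -/
lemma equivoc_map (e : Equiv.Perm J) (he : ∀ j, ν (e j) = ν j) {p' : W → J → α → ℝ≥0}
    (hp' : ∀ w j, Measurable (p' w j))
    {X : Finset J} (hpp : ∀ w, ∀ j ∈ X, p' w j = p w (e j)) :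
    equivoc ν p' X = equivoc ν p (X.map e.toEmbedding) := by
  have hmp : MeasurePreserving (fun (y : J → α) j => y (e j)) (Measure.pi ν) (Measure.pi ν) := by
    have := measurePreserving_piCongrLeft ν e
    simp_rw [he] at this
    have h2 := this.symm
    convert h2 using 1
    ext y j
    simp [MeasurableEquiv.piCongrLeft, Equiv.piCongrLeft]
  have hl : ∀ w y, lik p' X w (fun j => y (e j)) = lik p (X.map e.toEmbedding) w y := by
    intro w y
    simp only [lik, Finset.prod_map, Equiv.coe_toEmbedding]
    exact Finset.prod_congr rfl fun j hj => by rw [hpp w j hj]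
  refine Finset.sum_congr rfl fun w _ => ?_
  have hm : Measurable fun y =>
      (lik p' X w y : ℝ≥0∞) * ENNReal.ofReal (Real.log (tot p' X y / lik p' X w y)) :=
    (measurable_lik hp' X w).coe_nnreal_ennreal.mul (measurable_log_tot_div hp' X w).ennreal_ofReal
  rw [← hmp.lintegral_comp hm]
  simp only [tot, hl]

end Equivocation

/-! ### Complex Gaussian densities relative to CN(0,1). -/

section Gaussian

instance : IsProbabilityMeasure complexGaussian :=
  Measure.isProbabilityMeasure_map Complex.measurableEquivRealProd.symm.measurable.aemeasurable

lemma lintegral_complexGaussian {f : ℂ → ℝ≥0∞} (hf : Measurable f) :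
    ∫⁻ z, f z ∂complexGaussian
      = ∫⁻ a, ∫⁻ b, f ⟨a, b⟩ ∂gaussianReal 0 (1 / 2) ∂gaussianReal 0 (1 / 2) := by
  have hm : Measurable fun x => f (Complex.measurableEquivRealProd.symm x) :=
    hf.comp Complex.measurableEquivRealProd.symm.measurable
  rw [complexGaussian, lintegral_map hf Complex.measurableEquivRealProd.symm.measurable,
    lintegral_prod _ hm.aemeasurable]
  rfl

/-- The density of `N(s, 1/2)` with respect to `N(0, 1/2)`. -/
def shiftDensity (s x : ℝ) : ℝ := Real.exp (2 * s * x - s ^ 2)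

/-- The density of `N(0, v/2)` with respect to `N(0, 1/2)`. -/
def scaleDensity (v x : ℝ) : ℝ := (Real.sqrt v)⁻¹ * Real.exp ((1 - v⁻¹) * x ^ 2)

lemma lintegral_gaussianReal_mul {m : ℝ} {v : ℝ≥0} (hv : v ≠ 0) {d : ℝ → ℝ}
    (hd : ∀ x, gaussianPDFReal 0 (1 / 2) x * d x = gaussianPDFReal m v x)
    (hdm : Measurable d) {f : ℝ → ℝ≥0∞} (hf : Measurable f) :
    ∫⁻ x, ENNReal.ofReal (d x) * f x ∂gaussianReal 0 (1 / 2) = ∫⁻ x, f x ∂gaussianReal m v := by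
  have hm : Measurable fun x => ENNReal.ofReal (d x) * f x := hdm.ennreal_ofReal.mul hf
  rw [gaussianReal_of_var_ne_zero 0 (by norm_num), gaussianReal_of_var_ne_zero m hv,
    lintegral_withDensity_eq_lintegral_mul _ (measurable_gaussianPDF _ _) hm,
    lintegral_withDensity_eq_lintegral_mul _ (measurable_gaussianPDF _ _) hf]
  refine lintegral_congr fun x => ?_
  simp only [Pi.mul_apply, gaussianPDF]
  rw [← mul_assoc, ← ENNReal.ofReal_mul (gaussianPDFReal_nonneg _ _ _), hd]

lemma lintegral_shiftDensity_mul (s : ℝ) {f : ℝ → ℝ≥0∞} (hf : Measurable f) :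
    ∫⁻ x, ENNReal.ofReal (shiftDensity s x) * f x ∂gaussianReal 0 (1 / 2)
      = ∫⁻ x, f (s + x) ∂gaussianReal 0 (1 / 2) := by
  rw [lintegral_gaussianReal_mul (m := s) (v := 1 / 2) (by norm_num) _
    (by unfold shiftDensity; fun_prop) hf]
  · rw [← lintegral_map (μ := gaussianReal 0 (1 / 2)) hf (measurable_const_add s),
      gaussianReal_map_const_add, zero_add]
  · intro x
    simp only [gaussianPDFReal, shiftDensity]
    rw [mul_assoc, ← Real.exp_add]
    congr 2
    push_cast
    ring

lemma lintegral_scaleDensity {v : ℝ} (hv : 0 < v) :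
    ∫⁻ x, ENNReal.ofReal (scaleDensity v x) ∂gaussianReal 0 (1 / 2) = 1 := by
  have hv' : (v / 2).toNNReal ≠ 0 := (Real.toNNReal_pos.2 (by positivity)).ne'
  have := lintegral_gaussianReal_mul (m := 0) hv' (d := scaleDensity v) ?_
    (by unfold scaleDensity; fun_prop) (f := fun _ => 1) measurable_const
  · simpa using this
  · intro x
    simp only [gaussianPDFReal, scaleDensity, Real.coe_toNNReal (v / 2) (by positivity)]
    rw [mul_mul_mul_comm, ← Real.exp_add]
    have h1 : Real.sqrt (2 * Real.pi * (v / 2)) = Real.sqrt (2 * Real.pi * (1 / 2)) * Real.sqrt v := by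
      rw [← Real.sqrt_mul (by positivity)]; congr 1; ring
    rw [h1, mul_inv]
    push_cast
    congr 2
    field_simp
    ring

/-- The density of `CN(s, 1)` with respect to `CN(0, 1)`. -/
def complexShiftDensity (s z : ℂ) : ℝ≥0 :=
  (shiftDensity s.re z.re * shiftDensity s.im z.im).toNNReal

/-- The density of `CN(0, v)` with respect to `CN(0, 1)`. -/
def complexScaleDensity (v : ℝ) (z : ℂ) : ℝ≥0 :=
  (scaleDensity v z.re * scaleDensity v z.im).toNNReal

/-- Real and imaginary parts are independent, so the real translation formula applies to each in
turn. Weighting by the shift density thus models a received sample with mean `s`. -/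
lemma lintegral_complexShiftDensity_mul (s : ℂ) {f : ℂ → ℝ≥0∞} (hf : Measurable f) :
    ∫⁻ z, complexShiftDensity s z * f z ∂complexGaussian = ∫⁻ z, f (s + z) ∂complexGaussian := by
  have hm : Measurable (complexShiftDensity s) := by
    unfold complexShiftDensity shiftDensity
    fun_prop
  have hmk : Measurable fun x : ℝ × ℝ => (⟨x.1, x.2⟩ : ℂ) :=
    Complex.measurableEquivRealProd.symm.measurable
  rw [lintegral_complexGaussian (f := fun z => complexShiftDensity s z * f z)
    (hm.coe_nnreal_ennreal.mul hf), lintegral_complexGaussian (by fun_prop)]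
  have h1 : ∀ a b : ℝ, (complexShiftDensity s ⟨a, b⟩ : ℝ≥0∞)
      = ENNReal.ofReal (shiftDensity s.re a) * ENNReal.ofReal (shiftDensity s.im b) := by
    intro a b
    rw [← ENNReal.ofReal_mul (by unfold shiftDensity; positivity)]
    rfl
  have h2 : ∀ a : ℝ, ∫⁻ b, complexShiftDensity s ⟨a, b⟩ * f ⟨a, b⟩ ∂gaussianReal 0 (1 / 2)
      = ENNReal.ofReal (shiftDensity s.re a) *
        ∫⁻ b, f ⟨a, s.im + b⟩ ∂gaussianReal 0 (1 / 2) := by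
    intro a
    simp_rw [h1, mul_assoc]
    rw [lintegral_const_mul' _ _ (by simp), lintegral_shiftDensity_mul _
      (f := fun b => f ⟨a, b⟩) (hf.comp (hmk.comp (by fun_prop : Measurable fun b : ℝ => (a, b))))]
  simp_rw [h2]
  rw [lintegral_shiftDensity_mul s.re (f := fun a => ∫⁻ b, f ⟨a, s.im + b⟩ ∂gaussianReal 0 (1 / 2))]
  · rfl
  · exact Measurable.lintegral_prod_right' (f := fun x : ℝ × ℝ => f ⟨x.1, s.im + x.2⟩)
      (hf.comp (hmk.comp (by fun_prop : Measurable fun x : ℝ × ℝ => (x.1, s.im + x.2))))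

lemma lintegral_complexScaleDensity {v : ℝ} (hv : 0 < v) :
    ∫⁻ z, complexScaleDensity v z ∂complexGaussian = 1 := by
  have hm : Measurable (complexScaleDensity v) := by
    unfold complexScaleDensity scaleDensity
    fun_prop
  rw [lintegral_complexGaussian hm.coe_nnreal_ennreal]
  have h1 : ∀ a b : ℝ, (complexScaleDensity v ⟨a, b⟩ : ℝ≥0∞)
      = ENNReal.ofReal (scaleDensity v a) * ENNReal.ofReal (scaleDensity v b) := by
    intro a b
    rw [← ENNReal.ofReal_mul (by unfold scaleDensity; positivity)]
    rfl
  simp_rw [h1]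
  simp_rw [fun a => lintegral_const_mul' (μ := gaussianReal 0 (1 / 2))
    (ENNReal.ofReal (scaleDensity v a)) (fun b => ENNReal.ofReal (scaleDensity v b)) (by simp),
    lintegral_scaleDensity hv, mul_one]
  exact lintegral_scaleDensity hv

lemma lintegral_sq_gaussianReal :
    ∫⁻ x, ENNReal.ofReal (x ^ 2) ∂gaussianReal 0 (1 / 2) = ENNReal.ofReal (1 / 2) := by
  rw [← ofReal_integral_eq_lintegral_ofReal]
  · congr 1
    have h := variance_fun_id_gaussianReal (μ := 0) (v := 1 / 2)
    rw [variance_of_integral_eq_zero (by fun_prop) (by simp)] at h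
    simpa using h
  · exact (memLp_id_gaussianReal 2).integrable_sq
  · exact Eventually.of_forall fun x => sq_nonneg x

lemma lintegral_normSq_complexGaussian :
    ∫⁻ z, ENNReal.ofReal (‖z‖ ^ 2) ∂complexGaussian = 1 := by
  rw [lintegral_complexGaussian (by fun_prop)]
  have h1 : ∀ a b : ℝ, ENNReal.ofReal (‖(⟨a, b⟩ : ℂ)‖ ^ 2)
      = ENNReal.ofReal (a ^ 2) + ENNReal.ofReal (b ^ 2) := by
    intro a b
    rw [← ENNReal.ofReal_add (sq_nonneg _) (sq_nonneg _), ← Complex.normSq_eq_norm_sq,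
      Complex.normSq_mk]
    congr 1
    ring
  simp_rw [h1]
  simp_rw [fun a => lintegral_add_left (μ := gaussianReal 0 (1 / 2)) measurable_const
    (fun b => ENNReal.ofReal (b ^ 2)) (f := fun _ => ENNReal.ofReal (a ^ 2)), lintegral_sq_gaussianReal]
  rw [lintegral_add_left (by fun_prop)]
  simp only [lintegral_const, measure_univ, mul_one]
  rw [lintegral_sq_gaussianReal, ← ENNReal.ofReal_add (by norm_num) (by norm_num)]
  norm_num

end Gaussian

/-! ### Finite alphabets as point masses in ℂ, relative to the uniform law. -/

section Discrete

/-- The uniform distribution on `{0, …, q - 1}`, as a measure on `ℂ`. -/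
def discreteRef (q : ℕ) : Measure ℂ := (q : ℝ≥0∞)⁻¹ • ∑ i : Fin q, Measure.dirac ((i : ℕ) : ℂ)

instance (q : ℕ) [NeZero q] : IsProbabilityMeasure (discreteRef q) := by
  constructor
  simp [discreteRef, ENNReal.inv_mul_cancel (NeZero.ne (q : ℝ≥0∞))]

/-- The density of the point mass at `i` with respect to `discreteRef q`. -/
def discreteDensity (q : ℕ) (i : Fin q) (z : ℂ) : ℝ≥0 := if z = ((i : ℕ) : ℂ) then q else 0

lemma measurable_discreteDensity (q : ℕ) (i : Fin q) : Measurable (discreteDensity q i) :=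
  Measurable.ite (measurableSet_singleton _) measurable_const measurable_const

lemma lintegral_discreteRef (q : ℕ) (f : ℂ → ℝ≥0∞) :
    ∫⁻ z, f z ∂discreteRef q = (q : ℝ≥0∞)⁻¹ * ∑ i : Fin q, f ((i : ℕ) : ℂ) := by
  simp [discreteRef]

lemma lintegral_discreteDensity_mul (q : ℕ) [NeZero q] (i : Fin q) (f : ℂ → ℝ≥0∞) :
    ∫⁻ z, discreteDensity q i z * f z ∂discreteRef q = f ((i : ℕ) : ℂ) := by
  have h : ∀ j : Fin q, (discreteDensity q i ((j : ℕ) : ℂ) : ℝ≥0∞) * f ((j : ℕ) : ℂ)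
      = if j = i then q * f ((i : ℕ) : ℂ) else 0 := by
    intro j
    by_cases hj : j = i
    · subst hj; simp [discreteDensity]
    · have : ((j : ℕ) : ℂ) ≠ ((i : ℕ) : ℂ) := by
        simpa [Fin.val_inj] using hj
      simp [discreteDensity, hj, Fin.val_inj]
  rw [lintegral_discreteRef]
  simp_rw [h]
  rw [Finset.sum_ite_eq' Finset.univ i, if_pos (Finset.mem_univ i), ← mul_assoc,
    ENNReal.inv_mul_cancel (NeZero.ne (q : ℝ≥0∞)) (by simp), one_mul]

end Discrete

/-! ### Equivocation averaged over the fading. -/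

section Entropy

/-- The observations: the message of user `k`, the multicast symbol at time `t`, and the signal
at time `t` on receive antenna `i` of user `k`. -/
abbrev Obs (K N n : ℕ) : Type := Fin K ⊕ Fin n ⊕ (Fin n × Fin K × Fin N)

/-- Reference measures for the observations. -/
def obsRef {K n : ℕ} (N : ℕ) (m : Fin K → ℕ) (q : Fin n → ℕ) : Obs K N n → Measure ℂ
  | .inl k => discreteRef (m k)
  | .inr (.inl t) => discreteRef (q t)
  | .inr (.inr _) => complexGaussian

instance {K n N : ℕ} (m : Fin K → ℕ) (q : Fin n → ℕ) [∀ k, NeZero (m k)] [∀ t, NeZero (q t)]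
    (j : Obs K N n) : IsProbabilityMeasure (obsRef N m q j) := by
  rcases j with k | t | _ <;> simp only [obsRef] <;> infer_instance

instance (K M N Tc n : ℕ) : IsProbabilityMeasure (fadingLaw K M N Tc n) := by
  unfold fadingLaw; infer_instance

instance (K N n : ℕ) : IsProbabilityMeasure (noiseLaw K N n) := by
  unfold noiseLaw; infer_instance

variable {K M N Tc : ℕ} {γ : ℝ} {n : ℕ} {m : Fin K → ℕ}

/-- The noiseless part of the received signal. -/
def Code.mean (c : Code K M N Tc γ n m) (hT : 1 ≤ Tc) (w : Messages m) (H : Fading K M N Tc n)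
    (t : Fin n) (k : Fin K) (i : Fin N) : ℂ :=
  ∑ j, H (blockOf hT t) k i j * c.x t w H j

/-- The densities of the observations given the messages and the fading. -/
def Code.density (c : Code K M N Tc γ n m) (hT : 1 ≤ Tc) (H : Fading K M N Tc n)
    (w : Messages m) : Obs K N n → ℂ → ℝ≥0
  | .inl k => discreteDensity (m k) (w k)
  | .inr (.inl t) => discreteDensity (c.q t) (c.y₀ t w H)
  | .inr (.inr (t, k, i)) => complexShiftDensity (c.mean hT w H t k i)

lemma Code.measurable_mean (c : Code K M N Tc γ n m) (hT : 1 ≤ Tc) (w : Messages m) (t : Fin n)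
    (k : Fin K) (i : Fin N) : Measurable fun H => c.mean hT w H t k i := by
  unfold Code.mean
  refine Finset.measurable_sum _ fun j _ => Measurable.mul ?_ ?_
  · fun_prop
  · exact (measurable_pi_apply j).comp (c.measurable_x t w)

lemma Code.measurable_density_uncurry (c : Code K M N Tc γ n m) (hT : 1 ≤ Tc) (w : Messages m)
    (j : Obs K N n) :
    Measurable fun x : Fading K M N Tc n × ℂ => c.density hT x.1 w j x.2 := by
  rcases j with k | t | ⟨t, k, i⟩ <;> simp only [Code.density]
  · exact (measurable_discreteDensity _ _).comp measurable_snd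
  · refine Measurable.ite (measurableSet_eq_fun measurable_snd ?_) measurable_const measurable_const
    exact (measurable_of_countable fun a : Fin (c.q t) => ((a : ℕ) : ℂ)).comp
      ((c.measurable_y₀ t w).comp measurable_fst)
  · have : Measurable fun x : Fading K M N Tc n × ℂ => c.mean hT w x.1 t k i :=
      (c.measurable_mean hT w t k i).comp measurable_fst
    unfold complexShiftDensity shiftDensity
    fun_prop

lemma Code.measurable_density (c : Code K M N Tc γ n m) (hT : 1 ≤ Tc) (H : Fading K M N Tc n)
    (w : Messages m) (j : Obs K N n) : Measurable (c.density hT H w j) :=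
  (c.measurable_density_uncurry hT w j).comp measurable_prodMk_left

variable [∀ k, NeZero (m k)]

lemma Code.lintegral_density (c : Code K M N Tc γ n m) [∀ t, NeZero (c.q t)] (hT : 1 ≤ Tc)
    (H : Fading K M N Tc n) (w : Messages m) (j : Obs K N n) :
    ∫⁻ a, c.density hT H w j a ∂obsRef N m c.q j = 1 := by
  rcases j with k | t | ⟨t, k, i⟩ <;> simp only [Code.density, obsRef]
  · simpa using lintegral_discreteDensity_mul (m k) (w k) fun _ => 1
  · simpa using lintegral_discreteDensity_mul (c.q t) (c.y₀ t w H) fun _ => 1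
  · simpa using lintegral_complexShiftDensity_mul (c.mean hT w H t k i) (f := fun _ => 1)
      measurable_const

lemma Code.measurable_lik_uncurry (c : Code K M N Tc γ n m) (hT : 1 ≤ Tc) (w : Messages m)
    (X : Finset (Obs K N n)) :
    Measurable fun x : Fading K M N Tc n × (Obs K N n → ℂ) => lik (c.density hT x.1) X w x.2 := by
  unfold lik
  refine Finset.measurable_prod _ fun j _ => ?_
  exact (c.measurable_density_uncurry hT w j).comp
    (measurable_fst.prodMk ((measurable_pi_apply j).comp measurable_snd))

variable (c : Code K M N Tc γ n m) [∀ t, NeZero (c.q t)] (hT : 1 ≤ Tc)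

lemma Code.measurable_expect {F : Fading K M N Tc n → Messages m → (Obs K N n → ℂ) → ℝ}
    (hF : ∀ w, Measurable fun x : Fading K M N Tc n × (Obs K N n → ℂ) => F x.1 w x.2)
    (X : Finset (Obs K N n)) :
    Measurable fun H => expect (obsRef N m c.q) (c.density hT H) X (F H) := by
  unfold expect
  refine Finset.measurable_sum _ fun w _ => ?_
  exact Measurable.lintegral_prod_right'
    (f := fun x : Fading K M N Tc n × (Obs K N n → ℂ) =>
      (lik (c.density hT x.1) X w x.2 : ℝ≥0∞) * ENNReal.ofReal (F x.1 w x.2))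
    ((c.measurable_lik_uncurry hT w X).coe_nnreal_ennreal.mul (hF w).ennreal_ofReal)

lemma Code.measurable_equivoc (X : Finset (Obs K N n)) :
    Measurable fun H => equivoc (obsRef N m c.q) (c.density hT H) X := by
  refine c.measurable_expect hT
    (F := fun H w y => Real.log (tot (c.density hT H) X y / lik (c.density hT H) X w y)) ?_ X
  intro w
  refine Real.measurable_log.comp (Measurable.div ?_ ?_)
  · exact (Finset.measurable_sum _ fun w _ => c.measurable_lik_uncurry hT w X).coe_nnreal_real
  · exact (c.measurable_lik_uncurry hT w X).coe_nnreal_real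

/-- The equivocation of the messages given the observations in `X` and the fading. -/
def Code.ent (X : Finset (Obs K N n)) : ℝ :=
  (∫⁻ H, equivoc (obsRef N m c.q) (c.density hT H) X ∂fadingLaw K M N Tc n).toReal
    / Fintype.card (Messages m)

lemma card_messages_pos : 0 < (Fintype.card (Messages m) : ℝ) := by
  exact_mod_cast Fintype.card_pos

lemma Code.lintegral_equivoc_ne_top (X : Finset (Obs K N n)) :
    ∫⁻ H, equivoc (obsRef N m c.q) (c.density hT H) X ∂fadingLaw K M N Tc n ≠ ∞ := by
  refine ne_top_of_le_ne_top ?_ (lintegral_mono fun H =>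
    equivoc_le (c.measurable_density hT H) (c.lintegral_density hT H) X)
  rw [lintegral_const, measure_univ, mul_one]
  exact ENNReal.mul_ne_top (ENNReal.natCast_ne_top _) ENNReal.ofReal_ne_top

lemma Code.ent_anti {X Z : Finset (Obs K N n)} (hXZ : X ⊆ Z) : c.ent hT Z ≤ c.ent hT X := by
  unfold Code.ent
  gcongr
  · exact c.lintegral_equivoc_ne_top hT X
  · exact equivoc_anti (c.measurable_density hT _) (c.lintegral_density hT _) hXZ

lemma Code.ent_submod_insert {X Z : Finset (Obs K N n)} (hZX : Z ⊆ X) (j : Obs K N n) :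
    c.ent hT X - c.ent hT (insert j X) ≤ c.ent hT Z - c.ent hT (insert j Z) := by
  have h : ∫⁻ H, equivoc (obsRef N m c.q) (c.density hT H) (insert j Z) ∂fadingLaw K M N Tc n
      + ∫⁻ H, equivoc (obsRef N m c.q) (c.density hT H) X ∂fadingLaw K M N Tc n
      ≤ ∫⁻ H, equivoc (obsRef N m c.q) (c.density hT H) Z ∂fadingLaw K M N Tc n
      + ∫⁻ H, equivoc (obsRef N m c.q) (c.density hT H) (insert j X) ∂fadingLaw K M N Tc n := by
    rw [← lintegral_add_left (c.measurable_equivoc hT _),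
      ← lintegral_add_left (c.measurable_equivoc hT _)]
    exact lintegral_mono fun H => equivoc_add_insert_le (c.measurable_density hT H)
      (c.lintegral_density hT H) hZX j
  have f := c.lintegral_equivoc_ne_top hT
  have h' := ENNReal.toReal_mono (ENNReal.add_ne_top.2 ⟨f _, f _⟩) h
  rw [ENNReal.toReal_add (f _) (f _), ENNReal.toReal_add (f _) (f _)] at h'
  unfold Code.ent
  rw [← sub_div, ← sub_div]
  exact div_le_div_of_nonneg_right (by linarith) card_messages_pos.le

/-- Conditioning on more observations makes further observations less informative. -/
lemma Code.ent_submod {X Z : Finset (Obs K N n)} (hZX : Z ⊆ X) (A : Finset (Obs K N n)) :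
    c.ent hT X - c.ent hT (X ∪ A) ≤ c.ent hT Z - c.ent hT (Z ∪ A) := by
  induction A using Finset.induction_on with
  | empty => simp
  | insert j A _ ih =>
    rw [Finset.union_insert, Finset.union_insert]
    have := c.ent_submod_insert hT (Finset.union_subset_union_left hZX (t := A)) j
    linarith

lemma Code.ent_empty : c.ent hT ∅ = ∑ k, Real.log (m k) := by
  have h1 : Real.log (Fintype.card (Messages m)) = ∑ k, Real.log (m k) := by
    rw [Fintype.card_pi]
    push_cast
    rw [Real.log_prod fun k _ => by simp [NeZero.ne (m k)]]
    simp
  have h2 : 0 ≤ Real.log (Fintype.card (Messages m)) := Real.log_natCast_nonneg _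
  unfold Code.ent
  simp_rw [equivoc_empty]
  rw [lintegral_const, measure_univ, mul_one, ENNReal.toReal_mul, ENNReal.toReal_ofReal h2,
    ENNReal.toReal_natCast, mul_div_cancel_left₀ _ card_messages_pos.ne', h1]

/-- The messages of the users in `S`. -/
def msgObs (N n : ℕ) (S : Finset (Fin K)) : Finset (Obs K N n) := S.map ⟨Sum.inl, Sum.inl_injective⟩

lemma Code.ent_msgObs_univ : c.ent hT (msgObs N n Finset.univ) = 0 := by
  unfold Code.ent
  have : ∀ H, equivoc (obsRef N m c.q) (c.density hT H) (msgObs N n Finset.univ) = 0 := by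
    intro H
    refine equivoc_eq_zero fun w w' y hw hww' => ?_
    obtain ⟨k, hk⟩ := Function.ne_iff.1 hww'
    simp only [lik, msgObs, Finset.prod_map, Function.Embedding.coeFn_mk, Code.density] at hw ⊢
    refine Finset.prod_eq_zero (Finset.mem_univ k) ?_
    have h1 := Finset.prod_ne_zero_iff.1 hw k (Finset.mem_univ k)
    simp only [discreteDensity, ne_eq, ite_eq_right_iff, Classical.not_imp] at h1 ⊢
    intro h2
    exact absurd (Fin.ext (by exact_mod_cast h2.symm.trans h1.1)) hk
  simp [this]

/-- Bounding the information carried by the observation `j`, uniformly in the fading. -/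
lemma Code.ent_sub_insert_le {X : Finset (Obs K N n)} {j : Obs K N n}
    {G : Fading K M N Tc n → ℝ≥0∞} (hG : Measurable G) {B : ℝ} (hB : 0 ≤ B)
    (h : ∀ H, equivoc (obsRef N m c.q) (c.density hT H) X
      ≤ G H + equivoc (obsRef N m c.q) (c.density hT H) (insert j X))
    (hGB : ∫⁻ H, G H ∂fadingLaw K M N Tc n ≤ Fintype.card (Messages m) * ENNReal.ofReal B) :
    c.ent hT X - c.ent hT (insert j X) ≤ B := by
  have h1 : ∫⁻ H, equivoc (obsRef N m c.q) (c.density hT H) X ∂fadingLaw K M N Tc n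
      ≤ Fintype.card (Messages m) * ENNReal.ofReal B
      + ∫⁻ H, equivoc (obsRef N m c.q) (c.density hT H) (insert j X) ∂fadingLaw K M N Tc n :=
    calc _ ≤ ∫⁻ H, G H + equivoc (obsRef N m c.q) (c.density hT H) (insert j X)
            ∂fadingLaw K M N Tc n := lintegral_mono h
      _ = _ := lintegral_add_left hG _
      _ ≤ _ := by gcongr
  have f := c.lintegral_equivoc_ne_top hT
  have f' : (Fintype.card (Messages m) : ℝ≥0∞) * ENNReal.ofReal B ≠ ∞ :=
    ENNReal.mul_ne_top (ENNReal.natCast_ne_top _) ENNReal.ofReal_ne_top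
  have h' := ENNReal.toReal_mono (ENNReal.add_ne_top.2 ⟨f', f _⟩) h1
  rw [ENNReal.toReal_add f' (f _), ENNReal.toReal_mul, ENNReal.toReal_ofReal hB,
    ENNReal.toReal_natCast] at h'
  unfold Code.ent
  rw [← sub_div, div_le_iff₀ card_messages_pos]
  linarith

lemma expect_const {W J : Type*} [Fintype W] [Fintype J] [DecidableEq J] {ν : J → Measure ℂ}
    [∀ j, IsProbabilityMeasure (ν j)] {p : W → J → ℂ → ℝ≥0} (hp : ∀ w j, Measurable (p w j))
    (hp1 : ∀ w j, ∫⁻ a, p w j a ∂ν j = 1) (X : Finset J) (b : ℝ) :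
    expect ν p X (fun _ _ => b) = Fintype.card W * ENNReal.ofReal b := by
  unfold expect
  simp_rw [fun w => lintegral_mul_const' (μ := Measure.pi ν) (ENNReal.ofReal b)
    (fun y => (lik p X w y : ℝ≥0∞)) (by simp), lintegral_lik hp hp1]
  simp

/-- A bounded density bounds the information. -/
lemma Code.ent_sub_insert_le_log (X : Finset (Obs K N n)) (j : Obs K N n) {b : ℕ}
    (h : ∀ H w a, c.density hT H w j a ≤ b) :
    c.ent hT X - c.ent hT (insert j X) ≤ Real.log b := by
  have hlog : 0 ≤ Real.log b := Real.log_natCast_nonneg _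
  by_cases hj : j ∈ X
  · simpa [Finset.insert_eq_of_mem hj] using hlog
  refine c.ent_sub_insert_le hT (G := fun _ => Fintype.card (Messages m) * ENNReal.ofReal (Real.log b))
    measurable_const hlog (fun H => ?_) (by simp)
  have key := equivoc_le_insert (ν := obsRef N m c.q) (c.measurable_density hT H)
    (c.lintegral_density hT H) hj (r := fun _ => 1) measurable_const (by simp)
    (g := fun _ _ => Real.log b) (g' := fun _ _ => 0) (fun _ => measurable_const)
    (fun _ => measurable_const) (fun _ _ => hlog) (fun _ _ => le_rfl) ?_
  · rw [expect_const (c.measurable_density hT H) (c.lintegral_density hT H),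
      expect_const (c.measurable_density hT H) (c.lintegral_density hT H)] at key
    exact le_trans le_add_self key
  · intro w y hl
    refine ⟨one_ne_zero, ?_⟩
    have hpj := (lik_ne_zero_of_insert hj hl).1
    have : (c.density hT H w j (y j) : ℝ) ≤ b := by exact_mod_cast h H w (y j)
    simpa using Real.log_le_log (by positivity) this

/-- Relative to the uniform law, a point mass has density at most the alphabet size. -/
lemma Code.ent_sub_insert_msg_le (X : Finset (Obs K N n)) (k : Fin K) :
    c.ent hT X - c.ent hT (insert (Sum.inl k) X) ≤ Real.log (m k) := by
  refine c.ent_sub_insert_le_log hT X _ fun H w a => ?_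
  simp only [Code.density, discreteDensity]
  split_ifs <;> simp

lemma Code.ent_sub_insert_multicast_le (X : Finset (Obs K N n)) (t : Fin n) :
    c.ent hT X - c.ent hT (insert (Sum.inr (Sum.inl t)) X) ≤ Real.log (c.q t) := by
  refine c.ent_sub_insert_le_log hT X _ fun H w a => ?_
  simp only [Code.density, discreteDensity]
  split_ifs <;> simp

lemma Code.ent_sub_union_msgObs_le (X : Finset (Obs K N n)) (S : Finset (Fin K)) :
    c.ent hT X - c.ent hT (X ∪ msgObs N n S) ≤ ∑ k ∈ S, Real.log (m k) := by
  induction S using Finset.induction_on with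
  | empty => simp [msgObs]
  | insert k S hk ih =>
    have h1 : X ∪ msgObs N n (insert k S) = insert (Sum.inl k) (X ∪ msgObs N n S) := by
      simp [msgObs, Finset.map_insert, Finset.union_insert]
    have := c.ent_sub_insert_msg_le hT (X ∪ msgObs N n S) k
    rw [Finset.sum_insert hk, h1]
    linarith

/-- The messages of different users are independent and uniform. -/
lemma Code.ent_msgObs (S : Finset (Fin K)) :
    c.ent hT (msgObs N n S) = ∑ k ∈ Sᶜ, Real.log (m k) := by
  have h1 := c.ent_sub_union_msgObs_le hT ∅ S
  have h2 := c.ent_sub_union_msgObs_le hT (msgObs N n S) Sᶜ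
  have h3 : msgObs N n S ∪ msgObs N n Sᶜ = msgObs N n Finset.univ := by
    simp [msgObs, ← Finset.map_union]
  rw [h3, c.ent_msgObs_univ hT] at h2
  rw [c.ent_empty hT, Finset.empty_union] at h1
  have := Finset.sum_add_sum_compl S fun k => Real.log (m k : ℝ)
  linarith

end Entropy

/-! ### Product laws of noise, fading and observations. -/

section Laws

/-- On boxes the product density factorises, and boxes determine a product measure. This identifies
the likelihood formalism with an actual product law. -/
lemma lintegral_lik_univ {W J α : Type*} [Fintype J] [DecidableEq J] [MeasurableSpace α]
    {p : W → J → α → ℝ≥0} {ν : J → Measure α} [∀ j, IsProbabilityMeasure (ν j)]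
    (hp : ∀ w j, Measurable (p w j)) (hp1 : ∀ w j, ∫⁻ a, p w j a ∂ν j = 1) (w : W)
    {F : (J → α) → ℝ≥0∞} (hF : Measurable F) :
    ∫⁻ y, lik p Finset.univ w y * F y ∂Measure.pi ν
      = ∫⁻ y, F y ∂Measure.pi fun j => (ν j).withDensity fun a => p w j a := by
  classical
  have hprob : ∀ j, IsProbabilityMeasure ((ν j).withDensity fun a => (p w j a : ℝ≥0∞)) := fun j =>
    ⟨by rw [withDensity_apply _ MeasurableSet.univ, Measure.restrict_univ, hp1]⟩
  have hbox : ∀ (s : J → Set α), (∀ j, MeasurableSet (s j)) → ∀ X : Finset J,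
      ∫⁻ y, ∏ j ∈ X, ((s j).indicator (fun a => (p w j a : ℝ≥0∞)) (y j)) ∂Measure.pi ν
        = ∏ j ∈ X, ((ν j).withDensity fun a => (p w j a : ℝ≥0∞)) (s j) := by
    intro s hs X
    have hm : ∀ j, Measurable ((s j).indicator (fun a => (p w j a : ℝ≥0∞))) := fun j =>
      (hp w j).coe_nnreal_ennreal.indicator (hs j)
    induction X using Finset.induction_on with
    | empty => simp
    | insert j X hj ih =>
      rw [lintegral_pi_update ν j (by fun_prop)]
      have h1 : ∀ (y : J → α) a, ∏ i ∈ insert j X,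
          (s i).indicator (fun a => (p w i a : ℝ≥0∞)) (Function.update y j a i)
          = (s j).indicator (fun a => (p w j a : ℝ≥0∞)) a
            * ∏ i ∈ X, (s i).indicator (fun a => (p w i a : ℝ≥0∞)) (y i) := by
        intro y a
        rw [Finset.prod_insert hj, Function.update_self]
        congr 1
        refine Finset.prod_congr rfl fun i hi => ?_
        rw [Function.update_of_ne (by rintro rfl; exact hj hi)]
      simp_rw [h1, fun y : J → α => lintegral_mul_const (μ := ν j)
        (∏ i ∈ X, (s i).indicator (fun a => (p w i a : ℝ≥0∞)) (y i)) (hm j)]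
      rw [lintegral_const_mul _ (by fun_prop), ih, Finset.prod_insert hj,
        withDensity_apply _ (hs j), lintegral_indicator (hs j)]
  have hl : Measurable fun y => (lik p Finset.univ w y : ℝ≥0∞) :=
    (measurable_lik hp _ w).coe_nnreal_ennreal
  have key : (Measure.pi fun j => (ν j).withDensity fun a => (p w j a : ℝ≥0∞))
      = (Measure.pi ν).withDensity fun y => (lik p Finset.univ w y : ℝ≥0∞) := by
    refine Measure.pi_eq fun s hs => ?_
    rw [withDensity_apply _ (MeasurableSet.univ_pi hs), ← hbox s hs,
      ← lintegral_indicator (MeasurableSet.univ_pi hs)]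
    refine lintegral_congr fun y => ?_
    by_cases hy : ∀ j, y j ∈ s j
    · rw [Set.indicator_of_mem (by simpa using hy)]
      simp [lik, hy]
    · rw [Set.indicator_of_notMem (by simpa using hy)]
      push Not at hy
      obtain ⟨j, hj⟩ := hy
      exact (Finset.prod_eq_zero (Finset.mem_univ j) (by simp [hj])).symm
  rw [key, lintegral_withDensity_eq_lintegral_mul _ hl hF]
  rfl

lemma measurePreserving_pi_comp {J ι α : Type*} [Fintype J] [Fintype ι] [MeasurableSpace α]
    (μ : Measure α) [IsProbabilityMeasure μ] {e : ι → J} (he : Function.Injective e) :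
    MeasurePreserving (fun (z : J → α) i => z (e i)) (Measure.pi fun _ => μ)
      (Measure.pi fun _ => μ) := by
  refine ⟨by fun_prop, ?_⟩
  have h : iIndepFun (fun (j : J) (z : J → α) => z j) (Measure.pi fun _ => μ) :=
    iIndepFun_pi (X := fun _ => id) (fun _ => aemeasurable_id)
  have h2 := (iIndepFun_iff_map_fun_eq_pi_map (fun i => (measurable_pi_apply (e i)).aemeasurable)).1 (h.precomp he)
  rw [h2]
  congr 1
  funext i
  exact (measurePreserving_eval (fun _ : J => μ) (e i)).map_eq

lemma measurePreserving_pi_curry {ι κ α : Type*} [Fintype ι] [Fintype κ] [MeasurableSpace α]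
    (μ : Measure α) [IsProbabilityMeasure μ] :
    MeasurePreserving (fun (z : ι × κ → α) i j => z (i, j)) (Measure.pi fun _ => μ)
      (Measure.pi fun _ => Measure.pi fun _ => μ) := by
  refine ⟨by fun_prop, ?_⟩
  have := Measure.infinitePi_map_curry (ι := ι) (κ := κ) fun _ _ => μ
  simp only [Measure.infinitePi_eq_pi] at this
  exact this

variable {K M N Tc n : ℕ}

lemma measurePreserving_noise :
    MeasurePreserving (fun (z : Obs K N n → ℂ) t k i => z (Sum.inr (Sum.inr (t, k, i))))
      (Measure.pi fun _ => complexGaussian) (noiseLaw K N n) := by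
  have h1 := measurePreserving_pi_comp complexGaussian
    (e := fun x : Fin n × Fin K × Fin N => (Sum.inr (Sum.inr x) : Obs K N n))
    (Sum.inr_injective.comp Sum.inr_injective)
  have h2 := measurePreserving_pi_curry (ι := Fin n) (κ := Fin K × Fin N) complexGaussian
  have h3 := measurePreserving_pi (fun _ : Fin n => _) (fun _ : Fin n => _)
    fun _ => measurePreserving_pi_curry (ι := Fin K) (κ := Fin N) complexGaussian
  exact h3.comp (h2.comp h1)

lemma measurePreserving_fading_eval (b : Fin (numBlocks n Tc)) (k : Fin K) (i : Fin N)
    (a : Fin M) :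
    MeasurePreserving (fun H : Fading K M N Tc n => H b k i a) (fadingLaw K M N Tc n)
      complexGaussian :=
  (measurePreserving_eval (fun _ => complexGaussian) a).comp
    ((measurePreserving_eval (fun _ => Measure.pi fun _ => complexGaussian) i).comp
      ((measurePreserving_eval
        (fun _ => Measure.pi fun _ => Measure.pi fun _ => complexGaussian) k).comp
        (measurePreserving_eval (fun _ => Measure.pi fun _ => Measure.pi fun _ =>
          Measure.pi fun _ => complexGaussian) b)))

lemma lintegral_messageLaw (m : Fin K → ℕ) (f : Messages m → ℝ≥0∞) :
    ∫⁻ w, f w ∂messageLaw m = (Fintype.card (Messages m) : ℝ≥0∞)⁻¹ * ∑ w, f w := by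
  rw [lintegral_fintype, Finset.mul_sum]
  refine Finset.sum_congr rfl fun w _ => ?_
  rw [messageLaw, uniformOn_univ, Measure.count_singleton, one_div, mul_comm]

end Laws

/-! ### Information carried by one received sample. -/

section SingleLetterBound

variable {K M N Tc : ℕ} {γ : ℝ} {n : ℕ} {m : Fin K → ℕ} [∀ k, NeZero (m k)]
variable (c : Code K M N Tc γ n m) [∀ t, NeZero (c.q t)] (hT : 1 ≤ Tc)

section SingleLetter

/-- The energy of the input at time `t`. -/
def Code.energy (t : Fin n) : ℝ≥0∞ :=
  ∫⁻ ω, ∑ j, ‖c.x t ω.1 ω.2 j‖ₑ ^ 2 ∂((messageLaw m).prod (fadingLaw K M N Tc n))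

lemma Code.sum_lintegral_energy (t : Fin n) :
    ∑ w, ∫⁻ H, ∑ j, ‖c.x t w H j‖ₑ ^ 2 ∂fadingLaw K M N Tc n
      = Fintype.card (Messages m) * c.energy t := by
  have hm : Measurable fun ω : Messages m × Fading K M N Tc n => ∑ j, ‖c.x t ω.1 ω.2 j‖ₑ ^ 2 := by
    refine measurable_from_prod_countable_right fun w => ?_
    have := c.measurable_x t w
    simp only
    fun_prop
  rw [Code.energy, lintegral_prod _ hm.aemeasurable, lintegral_messageLaw, ← mul_assoc,
    ENNReal.mul_inv_cancel (by exact_mod_cast Fintype.card_ne_zero) (ENNReal.natCast_ne_top _),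
    one_mul]

/-- The squared norm of a row of the channel matrix. -/
def gain (b : Fin (numBlocks n Tc)) (k : Fin K) (i : Fin N) (H : Fading K M N Tc n) : ℝ :=
  ∑ a, ‖H b k i a‖ ^ 2

lemma gain_nonneg (b : Fin (numBlocks n Tc)) (k : Fin K) (i : Fin N) (H : Fading K M N Tc n) :
    0 ≤ gain b k i H := Finset.sum_nonneg fun _ _ => sq_nonneg _

lemma measurable_gain (b : Fin (numBlocks n Tc)) (k : Fin K) (i : Fin N) :
    Measurable (gain (M := M) b k i) := by
  unfold gain
  fun_prop

lemma lintegral_gain (b : Fin (numBlocks n Tc)) (k : Fin K) (i : Fin N) :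
    ∫⁻ H, ENNReal.ofReal (gain b k i H) ∂fadingLaw K M N Tc n = M := by
  unfold gain
  simp_rw [fun H : Fading K M N Tc n => ENNReal.ofReal_sum_of_nonneg (s := Finset.univ)
    (f := fun a => ‖H b k i a‖ ^ 2) fun _ _ => sq_nonneg _]
  rw [lintegral_finsetSum _ fun a _ => by fun_prop]
  have h : ∀ a : Fin M, ∫⁻ H, ENNReal.ofReal (‖H b k i a‖ ^ 2) ∂fadingLaw K M N Tc n = 1 := by
    intro a
    rw [← lintegral_normSq_complexGaussian]
    exact (measurePreserving_fading_eval b k i a).lintegral_comp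
      (f := fun z => ENNReal.ofReal (‖z‖ ^ 2)) (by fun_prop)
  rw [Finset.sum_congr rfl fun a _ => h a]
  simp

lemma Code.norm_mean_sq_le (w : Messages m) (H : Fading K M N Tc n) (t : Fin n) (k : Fin K)
    (i : Fin N) :
    ‖c.mean hT w H t k i‖ ^ 2 ≤ gain (blockOf hT t) k i H * ∑ j, ‖c.x t w H j‖ ^ 2 := by
  have h1 : ‖c.mean hT w H t k i‖ ≤ ∑ j, ‖H (blockOf hT t) k i j‖ * ‖c.x t w H j‖ := by
    refine (norm_sum_le _ _).trans_eq ?_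
    simp_rw [norm_mul]
  calc ‖c.mean hT w H t k i‖ ^ 2 ≤ (∑ j, ‖H (blockOf hT t) k i j‖ * ‖c.x t w H j‖) ^ 2 := by
        gcongr
    _ ≤ _ := Finset.sum_mul_sq_le_sq_mul_sq _ _ _

/-- The left side equals ‖z‖² - ‖z - s‖² and the right side equals ‖z‖². This compares the law
CN(s,1) with the test law CN(0,v), uniformly in the mean `s`. -/
lemma log_shiftDensity_le {v : ℝ} (hv : 0 < v) (s z : ℂ) :
    Real.log (complexShiftDensity s z)
      ≤ Real.log (complexScaleDensity v z) + (Real.log v + ‖z‖ ^ 2 / v) := by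
  have h1 : Real.log (complexShiftDensity s z)
      = 2 * s.re * z.re - s.re ^ 2 + (2 * s.im * z.im - s.im ^ 2) := by
    unfold complexShiftDensity shiftDensity
    rw [Real.coe_toNNReal _ (by positivity), ← Real.exp_add, Real.log_exp]
  have h2 : Real.log (complexScaleDensity v z) = -Real.log v + (1 - v⁻¹) * (z.re ^ 2 + z.im ^ 2) := by
    unfold complexScaleDensity scaleDensity
    have : (√v)⁻¹ * Real.exp ((1 - v⁻¹) * z.re ^ 2) * ((√v)⁻¹ * Real.exp ((1 - v⁻¹) * z.im ^ 2))
        = v⁻¹ * Real.exp ((1 - v⁻¹) * (z.re ^ 2 + z.im ^ 2)) := by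
      rw [mul_mul_mul_comm, ← mul_inv, Real.mul_self_sqrt hv.le, ← Real.exp_add]
      congr 2
      ring
    rw [Real.coe_toNNReal _ (by positivity), this, Real.log_mul (by positivity) (by positivity),
      Real.log_inv, Real.log_exp]
  have h3 : ‖z‖ ^ 2 = z.re ^ 2 + z.im ^ 2 := by
    rw [← Complex.normSq_eq_norm_sq, Complex.normSq_apply]
    ring
  rw [h1, h2, h3]
  have : (1 - v⁻¹) * (z.re ^ 2 + z.im ^ 2) + (z.re ^ 2 + z.im ^ 2) / v = z.re ^ 2 + z.im ^ 2 := by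
    field_simp
    ring
  nlinarith [sq_nonneg (z.re - s.re), sq_nonneg (z.im - s.im)]

/-- After translation by `s`, use log(1 + g) ≤ g and ‖s + z‖² ≤ 2‖s‖² + 2‖z‖². Dividing by P(1 + g)
removes the gain from ‖s‖² ≤ g e, and E‖z‖² = 1 accounts for the constant 2. -/
lemma lintegral_shift_log_le {P g e : ℝ} (hP : 1 ≤ P) (hg : 0 ≤ g) {s : ℂ}
    (hs : ‖s‖ ^ 2 ≤ g * e) (he : 0 ≤ e) :
    ∫⁻ z, complexShiftDensity s z *
        ENNReal.ofReal (Real.log (P * (1 + g)) + ‖z‖ ^ 2 / (P * (1 + g))) ∂complexGaussian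
      ≤ ENNReal.ofReal (Real.log P + 2) + ENNReal.ofReal g
        + ENNReal.ofReal (2 / P) * ENNReal.ofReal e := by
  have hP0 : 0 < P := by linarith
  have hlP : 0 ≤ Real.log P := Real.log_nonneg hP
  have hv : 1 ≤ P * (1 + g) := by nlinarith
  rw [lintegral_complexShiftDensity_mul s (f := fun z => ENNReal.ofReal
    (Real.log (P * (1 + g)) + ‖z‖ ^ 2 / (P * (1 + g)))) (by fun_prop)]
  have hpt : ∀ z : ℂ, ENNReal.ofReal (Real.log (P * (1 + g)) + ‖s + z‖ ^ 2 / (P * (1 + g)))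
      ≤ ENNReal.ofReal (Real.log P + g + 2 / P * e) + ENNReal.ofReal 2 * ENNReal.ofReal (‖z‖ ^ 2) := by
    intro z
    rw [← ENNReal.ofReal_mul zero_le_two, ← ENNReal.ofReal_add (by positivity) (by positivity)]
    refine ENNReal.ofReal_le_ofReal ?_
    have h1 : Real.log (P * (1 + g)) ≤ Real.log P + g := by
      rw [Real.log_mul (by positivity) (by positivity)]
      have := Real.log_le_sub_one_of_pos (show 0 < 1 + g by linarith)
      linarith
    have h2 : ‖s + z‖ ^ 2 ≤ 2 * ‖s‖ ^ 2 + 2 * ‖z‖ ^ 2 := by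
      have := norm_add_le s z
      nlinarith [sq_nonneg (‖s‖ - ‖z‖), norm_nonneg (s + z)]
    have h3 : ‖s + z‖ ^ 2 / (P * (1 + g)) ≤ 2 / P * e + 2 * ‖z‖ ^ 2 := by
      rw [div_le_iff₀ (by positivity)]
      have h4 : 2 * ‖s‖ ^ 2 ≤ 2 / P * e * (P * (1 + g)) := by
        have : 2 / P * e * (P * (1 + g)) = 2 * (e + g * e) := by field_simp
        rw [this]
        linarith
      have h5 : 2 * ‖z‖ ^ 2 ≤ 2 * ‖z‖ ^ 2 * (P * (1 + g)) := by
        nlinarith [sq_nonneg ‖z‖]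
      linarith
    linarith
  refine (lintegral_mono hpt).trans ?_
  rw [lintegral_add_left measurable_const, lintegral_const, measure_univ, mul_one,
    lintegral_const_mul' _ _ (by simp), lintegral_normSq_complexGaussian, mul_one,
    ← ENNReal.ofReal_mul (by positivity), ← ENNReal.ofReal_add (by positivity) (by positivity),
    ← ENNReal.ofReal_add (by positivity) (by positivity),
    ← ENNReal.ofReal_add (by positivity) (by positivity)]
  apply ENNReal.ofReal_le_ofReal
  linarith

lemma lintegral_lik_singleton {W J : Type*} [Fintype J] [DecidableEq J] {ν : J → Measure ℂ}
    [∀ j, IsProbabilityMeasure (ν j)] {p : W → J → ℂ → ℝ≥0} (hp : ∀ w j, Measurable (p w j))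
    (j : J) (w : W) {f : ℂ → ℝ≥0∞} (hf : Measurable f) :
    ∫⁻ y, lik p (insert j ∅) w y * f (y j) ∂Measure.pi ν = ∫⁻ a, p w j a * f a ∂ν j := by
  have hm : Measurable fun a => (p w j a : ℝ≥0∞) * f a := (hp w j).coe_nnreal_ennreal.mul hf
  rw [← (measurePreserving_eval ν j).lintegral_comp hm]
  simp [lik]

/-- The information carried by one received sample is at most `log P + O(1)`. -/
lemma Code.ent_sub_received_le {P : ℝ} (hP : 1 ≤ P) (t : Fin n) (ht : c.energy t ≠ ∞)
    (k : Fin K) (i : Fin N) :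
    c.ent hT ∅ - c.ent hT (insert (Sum.inr (Sum.inr (t, k, i))) ∅)
      ≤ Real.log P + 2 + M + 2 / P * (c.energy t).toReal := by
  have hP0 : 0 < P := by linarith
  have hlP : 0 ≤ Real.log P := Real.log_nonneg hP
  set j : Obs K N n := Sum.inr (Sum.inr (t, k, i)) with hj
  let b := blockOf hT t
  -- The test variance may depend on the fading but not on the messages. The factor 1 + gain
  -- dominates the gain in the Cauchy–Schwarz bound for the mean and keeps `v ≥ 1`; its logarithm
  -- costs at most the gain, whose expectation is `M`.
  let v : Fading K M N Tc n → ℝ := fun H => P * (1 + gain b k i H)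
  have hv1 : ∀ H, 1 ≤ v H := fun H => by
    have := gain_nonneg b k i H
    simp only [v]; nlinarith
  have hvm : Measurable v := by
    have := measurable_gain (M := M) b k i
    simp only [v]; fun_prop
  let g : Fading K M N Tc n → Messages m → (Obs K N n → ℂ) → ℝ :=
    fun H _ y => Real.log (v H) + ‖y j‖ ^ 2 / v H
  have hg0 : ∀ H w y, 0 ≤ g H w y := fun H w y => by
    have := hv1 H
    have := Real.log_nonneg this
    simp only [g]; positivity
  refine c.ent_sub_insert_le hT
    (G := fun H => expect (obsRef N m c.q) (c.density hT H) (insert j ∅) (g H))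
    (c.measurable_expect hT (fun w => by simp only [g]; fun_prop) _) (by positivity) ?_ ?_
  · intro H
    have hv : 0 < v H := lt_of_lt_of_le one_pos (hv1 H)
    refine le_trans le_add_self (equivoc_le_insert (c.measurable_density hT H)
      (c.lintegral_density hT H) (Finset.notMem_empty j)
      (r := fun y => complexScaleDensity (v H) (y j)) ?_ ?_ (g := g H) (g' := fun _ _ => 0)
      ?_ (fun _ => measurable_const) (hg0 H) (fun _ _ => le_rfl) ?_)
    · unfold complexScaleDensity scaleDensity
      fun_prop
    · intro y
      simp only [Function.update_self]
      exact (lintegral_complexScaleDensity hv).le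
    · intro w; simp only [g]; fun_prop
    · intro w y _
      refine ⟨?_, ?_⟩
      · unfold complexScaleDensity scaleDensity
        rw [Ne, Real.toNNReal_eq_zero, not_le]
        positivity
      · rw [add_zero]
        exact log_shiftDensity_le hv _ _
  · have h1 : ∀ H, expect (obsRef N m c.q) (c.density hT H) (insert j ∅) (g H)
        ≤ ∑ w : Messages m, (ENNReal.ofReal (Real.log P + 2) + ENNReal.ofReal (gain b k i H)
          + ENNReal.ofReal (2 / P) * ∑ a, ‖c.x t w H a‖ₑ ^ 2) := by
      intro H
      refine Finset.sum_le_sum fun w _ => ?_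
      rw [lintegral_lik_singleton (c.measurable_density hT H) j w
        (f := fun a => ENNReal.ofReal (Real.log (v H) + ‖a‖ ^ 2 / v H)) (by fun_prop)]
      refine (lintegral_shift_log_le hP (gain_nonneg b k i H)
        (c.norm_mean_sq_le hT w H t k i) (by positivity)).trans_eq ?_
      congr 2
      rw [ENNReal.ofReal_sum_of_nonneg fun _ _ => sq_nonneg _]
      refine Finset.sum_congr rfl fun a _ => ?_
      rw [ENNReal.ofReal_pow (norm_nonneg _), ofReal_norm]
    have hxm : ∀ w, Measurable fun H => ∑ a, ‖c.x t w H a‖ₑ ^ 2 := fun w => by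
      have := c.measurable_x t w
      fun_prop
    have hgm := measurable_gain (M := M) b k i
    refine (lintegral_mono h1).trans_eq ?_
    rw [lintegral_finsetSum _ fun w _ => by have := hxm w; fun_prop]
    have h2 : ∀ w : Messages m, ∫⁻ H, (ENNReal.ofReal (Real.log P + 2)
          + ENNReal.ofReal (gain b k i H) + ENNReal.ofReal (2 / P) * ∑ a, ‖c.x t w H a‖ₑ ^ 2)
          ∂fadingLaw K M N Tc n
        = ENNReal.ofReal (Real.log P + 2) + M
          + ENNReal.ofReal (2 / P) * ∫⁻ H, ∑ a, ‖c.x t w H a‖ₑ ^ 2 ∂fadingLaw K M N Tc n := by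
      intro w
      rw [lintegral_add_left (by fun_prop), lintegral_add_left measurable_const, lintegral_gain,
        lintegral_const_mul' _ _ (by simp), lintegral_const, measure_univ, mul_one]
    simp_rw [h2]
    rw [Finset.sum_add_distrib, ← Finset.mul_sum, c.sum_lintegral_energy, Finset.sum_const,
      Finset.card_univ, nsmul_eq_mul, mul_left_comm, ← mul_add,
      ENNReal.ofReal_add (p := Real.log P + 2 + M) (by positivity) (by positivity),
      ENNReal.ofReal_add (p := Real.log P + 2) (by positivity) (by positivity),
      ENNReal.ofReal_natCast, ENNReal.ofReal_mul (by positivity), ENNReal.ofReal_toReal ht]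

end SingleLetter

end SingleLetterBound

/-! ### Error probability and Fano's inequality. -/

section FanoBound

variable {K M N Tc : ℕ} {γ : ℝ} {n : ℕ} {m : Fin K → ℕ} [∀ k, NeZero (m k)]
variable (c : Code K M N Tc γ n m) [∀ t, NeZero (c.q t)] (hT : 1 ≤ Tc)

section Fano

/-- The symbol encoded by a complex number. -/
def decodeSymbol (q : ℕ) [NeZero q] (z : ℂ) : Fin q := Fin.ofNat q ⌊z.re⌋₊

lemma decodeSymbol_natCast {q : ℕ} [NeZero q] (i : Fin q) : decodeSymbol q ((i : ℕ) : ℂ) = i := by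
  simp [decodeSymbol]

lemma measurable_decodeSymbol (q : ℕ) [NeZero q] : Measurable (decodeSymbol q) :=
  (measurable_of_countable (Fin.ofNat q)).comp (Nat.measurable_floor.comp Complex.measurable_re)

/-- The multicast symbols sent at the times in `τ`. -/
def multicastObs (K N : ℕ) {n : ℕ} (τ : Finset (Fin n)) : Finset (Obs K N n) :=
  τ.map ⟨fun t => Sum.inr (Sum.inl t), Sum.inr_injective.comp Sum.inl_injective⟩

/-- The signals received at the times in `τ` by the users in `A`. -/
def receivedObs (N : ℕ) {K n : ℕ} (A : Finset (Fin K)) (τ : Finset (Fin n)) :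
    Finset (Obs K N n) :=
  (τ ×ˢ A ×ˢ Finset.univ).map ⟨fun x => Sum.inr (Sum.inr x), Sum.inr_injective.comp Sum.inr_injective⟩

@[simp] lemma inl_mem_multicastObs {τ : Finset (Fin n)} {k : Fin K} :
    Sum.inl k ∉ multicastObs K N τ := by simp [multicastObs]

@[simp] lemma inl_mem_receivedObs {A : Finset (Fin K)} {τ : Finset (Fin n)} {k : Fin K} :
    Sum.inl k ∉ receivedObs N A τ := by simp [receivedObs]

@[simp] lemma received_mem_receivedObs {A : Finset (Fin K)} {τ : Finset (Fin n)} {t : Fin n}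
    {k : Fin K} {i : Fin N} :
    Sum.inr (Sum.inr (t, k, i)) ∈ receivedObs N A τ ↔ t ∈ τ ∧ k ∈ A := by simp [receivedObs]

@[simp] lemma multicast_mem_multicastObs {τ : Finset (Fin n)} {t : Fin n} :
    Sum.inr (Sum.inl t) ∈ multicastObs K N τ ↔ t ∈ τ := by simp [multicastObs]

/-- The decision of user `k`, as a function of all observations. -/
def Code.estimate (k : Fin K) (H : Fading K M N Tc n) (y : Obs K N n → ℂ) : Fin (m k) :=
  c.dec k (fun t i => y (Sum.inr (Sum.inr (t, k, i))),
    fun t => decodeSymbol (c.q t) (y (Sum.inr (Sum.inl t))), H)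

lemma Code.measurable_estimate (k : Fin K) :
    Measurable fun x : Fading K M N Tc n × (Obs K N n → ℂ) => c.estimate k x.1 x.2 := by
  refine (c.measurable_dec k).comp (Measurable.prodMk ?_ (Measurable.prodMk ?_ measurable_fst))
  · fun_prop
  · refine measurable_pi_lambda _ fun t => (measurable_decodeSymbol _).comp ?_
    fun_prop

/-- How an observation arises from a noise sample. -/
def Code.observe (H : Fading K M N Tc n) (w : Messages m) : Obs K N n → ℂ → ℂ
  | .inl k => fun _ => ((w k : ℕ) : ℂ)
  | .inr (.inl t) => fun _ => ((c.y₀ t w H : ℕ) : ℂ)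
  | .inr (.inr (t, k, i)) => fun z => c.mean hT w H t k i + z

lemma Code.measurable_observe (H : Fading K M N Tc n) (w : Messages m) (j : Obs K N n) :
    Measurable (c.observe hT H w j) := by
  rcases j with k | t | ⟨t, k, i⟩ <;> simp only [Code.observe] <;> fun_prop

lemma Code.withDensity_density (H : Fading K M N Tc n) (w : Messages m) (j : Obs K N n) :
    ((obsRef N m c.q j).withDensity fun a => c.density hT H w j a)
      = complexGaussian.map (c.observe hT H w j) := by
  refine Measure.ext_of_lintegral _ fun f hf => ?_
  have hm : Measurable fun a => (c.density hT H w j a : ℝ≥0∞) :=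
    (c.measurable_density hT H w j).coe_nnreal_ennreal
  rw [lintegral_withDensity_eq_lintegral_mul _ hm hf, lintegral_map hf (c.measurable_observe hT H w j)]
  rcases j with k | t | ⟨t, k, i⟩ <;> simp only [Code.observe, Code.density, obsRef, Pi.mul_apply]
  · rw [lintegral_discreteDensity_mul]; simp
  · rw [lintegral_discreteDensity_mul]; simp
  · rw [lintegral_complexShiftDensity_mul _ hf]

lemma Code.lintegral_lik_univ_density (H : Fading K M N Tc n) (w : Messages m)
    {F : (Obs K N n → ℂ) → ℝ≥0∞} (hF : Measurable F) :
    ∫⁻ y, lik (c.density hT H) Finset.univ w y * F y ∂Measure.pi (obsRef N m c.q)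
      = ∫⁻ z, F (fun j => c.observe hT H w j (z j)) ∂Measure.pi fun _ => complexGaussian := by
  rw [lintegral_lik_univ (c.measurable_density hT H) (c.lintegral_density hT H) w hF]
  simp_rw [c.withDensity_density hT H w]
  have : ∀ j, SigmaFinite (complexGaussian.map (c.observe hT H w j)) := fun j =>
    have := Measure.isProbabilityMeasure_map (μ := complexGaussian)
      (c.measurable_observe hT H w j).aemeasurable
    inferInstance
  rw [← Measure.pi_map_pi fun j => (c.measurable_observe hT H w j).aemeasurable, lintegral_map hF]
  refine measurable_pi_lambda _ fun j => (c.measurable_observe hT H w j).comp (measurable_pi_apply j)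

/-- The decision of user `k` looks only at the multicast symbols and at its own samples. All other
observations integrate out, so the decision has the same law as in the actual channel. -/
lemma Code.lintegral_lik_error (H : Fading K M N Tc n) (w : Messages m) (k : Fin K)
    {Z : Finset (Obs K N n)} (hZ : multicastObs K N Finset.univ ∪ receivedObs N {k} Finset.univ ⊆ Z)
    {f : Fin (m k) → ℝ≥0∞} :
    ∫⁻ y, lik (c.density hT H) Z w y * f (c.estimate k H y) ∂Measure.pi (obsRef N m c.q)
      = ∫⁻ z, f (c.decoded hT w H z k) ∂noiseLaw K N n := by
  have hest : Measurable (c.estimate k H) := (c.measurable_estimate k).comp measurable_prodMk_left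
  have hf : Measurable f := measurable_of_countable f
  have h1 := lintegral_lik_subset (ν := obsRef N m c.q) (c.measurable_density hT H)
    (c.lintegral_density hT H) (Finset.subset_univ Z) w (hf.comp hest) ?_
  · have hF : Measurable fun z : Noise K N n => f (c.decoded hT w H z k) := by
      refine hf.comp ((c.measurable_dec k).comp (Measurable.prodMk ?_ measurable_const))
      unfold Code.received
      fun_prop
    simp only [Function.comp_def] at h1
    rw [← h1, c.lintegral_lik_univ_density hT H w (F := fun y => f (c.estimate k H y)) (hf.comp hest),
      ← measurePreserving_noise.lintegral_comp hF]
    refine lintegral_congr fun z => ?_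
    congr 1
    simp only [Code.estimate, Code.observe, Code.decoded, Code.mean,
      decodeSymbol_natCast]
    rfl
  · intro j hj y a
    have hj' : j ∉ multicastObs K N Finset.univ ∪ receivedObs N {k} Finset.univ :=
      fun h => hj (hZ h)
    simp only [Function.comp_apply, Code.estimate]
    congr 2
    refine Prod.ext ?_ (Prod.ext ?_ rfl)
    · funext t i
      exact Function.update_of_ne (by rintro rfl; simp at hj') _ _
    · funext t
      simp only
      rw [Function.update_of_ne (by rintro rfl; simp at hj')]

lemma Code.measurable_decoded_uncurry (k : Fin K) (w : Messages m) :
    Measurable fun x : Fading K M N Tc n × Noise K N n => c.decoded hT w x.1 x.2 k := by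
  refine (c.measurable_dec k).comp (Measurable.prodMk ?_ (Measurable.prodMk ?_ measurable_fst))
  · refine measurable_pi_lambda _ fun t => measurable_pi_lambda _ fun i => ?_
    have : Measurable fun x : Fading K M N Tc n × Noise K N n => c.mean hT w x.1 t k i :=
      (c.measurable_mean hT w t k i).comp measurable_fst
    exact Measurable.add this (by fun_prop)
  · exact measurable_pi_lambda _ fun t => (c.measurable_y₀ t w).comp measurable_fst

lemma Code.measurable_decoded (k : Fin K) :
    Measurable fun ω : Messages m × Fading K M N Tc n × Noise K N n =>
      c.decoded hT ω.1 ω.2.1 ω.2.2 k := by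
  refine measurable_from_prod_countable_right fun w => ?_
  exact c.measurable_decoded_uncurry hT k w

lemma Code.sum_lintegral_error_le (k : Fin K) :
    ∑ w : Messages m, ∫⁻ H, ∫⁻ z, (if c.decoded hT w H z k = w k then 0 else 1) ∂noiseLaw K N n
        ∂fadingLaw K M N Tc n
      ≤ Fintype.card (Messages m) * c.errorProb hT := by
  have hdec := c.measurable_decoded hT k
  have hs : MeasurableSet {ω : Messages m × Fading K M N Tc n × Noise K N n |
      c.decoded hT ω.1 ω.2.1 ω.2.2 k ≠ ω.1 k} :=
    (measurableSet_eq_fun hdec ((measurable_pi_apply k).comp measurable_fst)).compl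
  have h1 : jointLaw M N Tc n m {ω | c.decoded hT ω.1 ω.2.1 ω.2.2 k ≠ ω.1 k} ≤ c.errorProb hT :=
    measure_mono fun ω hω => ⟨k, hω⟩
  rw [← lintegral_indicator_one hs, jointLaw,
    lintegral_prod _ (measurable_one.indicator hs).aemeasurable, lintegral_messageLaw] at h1
  have h2 : ∀ w : Messages m, ∫⁻ x, {ω : Messages m × Fading K M N Tc n × Noise K N n |
        c.decoded hT ω.1 ω.2.1 ω.2.2 k ≠ ω.1 k}.indicator 1 (w, x)
        ∂(fadingLaw K M N Tc n).prod (noiseLaw K N n)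
      = ∫⁻ H, ∫⁻ z, (if c.decoded hT w H z k = w k then 0 else 1) ∂noiseLaw K N n
        ∂fadingLaw K M N Tc n := by
    intro w
    have hm : Measurable fun x => {ω : Messages m × Fading K M N Tc n × Noise K N n |
        c.decoded hT ω.1 ω.2.1 ω.2.2 k ≠ ω.1 k}.indicator (1 : Messages m × Fading K M N Tc n × Noise K N n → ℝ≥0∞) (w, x) :=
      (measurable_one.indicator hs).comp measurable_prodMk_left
    rw [lintegral_prod _ hm.aemeasurable]
    refine lintegral_congr fun H => lintegral_congr fun z => ?_
    simp [Set.indicator_apply]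
  simp_rw [h2] at h1
  calc _ = (Fintype.card (Messages m) : ℝ≥0∞) * ((Fintype.card (Messages m) : ℝ≥0∞)⁻¹ *
        ∑ w : Messages m, ∫⁻ H, ∫⁻ z, (if c.decoded hT w H z k = w k then 0 else 1)
          ∂noiseLaw K N n ∂fadingLaw K M N Tc n) := by
        rw [← mul_assoc, ENNReal.mul_inv_cancel (by exact_mod_cast Fintype.card_ne_zero)
          (ENNReal.natCast_ne_top _), one_mul]
    _ ≤ _ := by gcongr

lemma Code.measurable_errorProb_fading (k : Fin K) (w : Messages m) : Measurable fun H =>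
    ∫⁻ z, (if c.decoded hT w H z k = w k then (0 : ℝ≥0∞) else 1) ∂noiseLaw K N n := by
  have hd := c.measurable_decoded_uncurry hT k w
  have hs : MeasurableSet {x : Fading K M N Tc n × Noise K N n | c.decoded hT w x.1 x.2 k = w k} :=
    hd (measurableSet_singleton (w k))
  have hf : Measurable fun x : Fading K M N Tc n × Noise K N n =>
      if c.decoded hT w x.1 x.2 k = w k then (0 : ℝ≥0∞) else 1 :=
    Measurable.ite hs measurable_const measurable_const
  exact hf.lintegral_prod_right'

/-- Fano's inequality for user `k`. -/
lemma Code.ent_fano {ε : ℝ} (hε : 0 ≤ ε) (herr : c.errorProb hT ≤ ENNReal.ofReal ε) (k : Fin K) :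
    c.ent hT (multicastObs K N Finset.univ ∪ receivedObs N {k} Finset.univ)
      - c.ent hT (insert (Sum.inl k)
        (multicastObs K N Finset.univ ∪ receivedObs N {k} Finset.univ))
      ≤ Real.log 2 + ε * Real.log (m k) := by
  set X : Finset (Obs K N n) := multicastObs K N Finset.univ ∪ receivedObs N {k} Finset.univ with hX
  have hj : (Sum.inl k : Obs K N n) ∉ X := by simp [hX]
  have hlog : 0 ≤ Real.log (m k) := Real.log_natCast_nonneg _
  have hlog2 : 0 ≤ Real.log 2 := Real.log_nonneg one_le_two
  have hmpos : 0 < (m k : ℝ) := by exact_mod_cast Nat.pos_of_ne_zero (NeZero.ne (m k))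
  let g : Fading K M N Tc n → Messages m → (Obs K N n → ℂ) → ℝ := fun H w y =>
    Real.log 2 + if c.estimate k H y = w k then 0 else Real.log (m k)
  have hg0 : ∀ H w y, 0 ≤ g H w y := fun H w y => by
    simp only [g]; split_ifs <;> positivity
  have hgm : ∀ w, Measurable fun x : Fading K M N Tc n × (Obs K N n → ℂ) => g x.1 w x.2 := fun w =>
    measurable_const.add (Measurable.ite
      (measurableSet_eq_fun (c.measurable_estimate k) measurable_const) measurable_const
      measurable_const)
  refine c.ent_sub_insert_le hT
    (G := fun H => expect (obsRef N m c.q) (c.density hT H) (insert (Sum.inl k) X) (g H))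
    (c.measurable_expect hT hgm _) (by positivity) ?_ ?_
  · intro H
    have hest : Measurable (c.estimate k H) := (c.measurable_estimate k).comp measurable_prodMk_left
    -- The test law of the message is half the point mass at the decision and half uniform. A
    -- correct decision costs log 2, a wrong one log 2 + log `m k`.
    refine le_trans le_add_self (equivoc_le_insert (c.measurable_density hT H)
      (c.lintegral_density hT H) hj
      (r := fun y => discreteDensity (m k) (c.estimate k H y) (y (Sum.inl k)) / 2 + 1 / 2)
      ?_ ?_ (g := g H) (g' := fun _ _ => 0)
      (fun w => (hgm w).comp measurable_prodMk_left) (fun _ => measurable_const) (hg0 H)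
      (fun _ _ => le_rfl) ?_)
    · unfold discreteDensity
      refine Measurable.add_const (Measurable.div_const (Measurable.ite (measurableSet_eq_fun
        (measurable_pi_apply _) ?_) measurable_const measurable_const) _) _
      exact (measurable_of_countable fun a : Fin (m k) => ((a : ℕ) : ℂ)).comp hest
    · intro y
      have h1 : ∀ a, c.estimate k H (Function.update y (Sum.inl k) a) = c.estimate k H y := by
        intro a; simp [Code.estimate]
      simp only [h1, Function.update_self, obsRef]
      have h2 := lintegral_discreteDensity_mul (m k) (c.estimate k H y) fun _ => 2⁻¹
      have h3 : ∀ a, ((discreteDensity (m k) (c.estimate k H y) a / 2 + 1 / 2 : ℝ≥0) : ℝ≥0∞)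
          = discreteDensity (m k) (c.estimate k H y) a * 2⁻¹ + 2⁻¹ := by
        intro a
        rw [ENNReal.coe_add, div_eq_mul_inv, one_div, ENNReal.coe_mul, ENNReal.coe_inv two_ne_zero]
        rfl
      simp_rw [h3]
      rw [lintegral_add_right _ measurable_const, h2, lintegral_const, measure_univ, mul_one,
        ENNReal.inv_two_add_inv_two]
    · intro w y hl
      have hpj := (lik_ne_zero_of_insert hj hl).1
      simp only [Code.density, discreteDensity, ne_eq, ite_eq_right_iff, Classical.not_imp] at hpj
      refine ⟨by positivity, ?_⟩
      simp only [Code.density, discreteDensity, hpj.1, if_true, add_zero, g]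
      by_cases hest : c.estimate k H y = w k
      · rw [if_pos (by rw [hest]), if_pos hest, add_zero, ← Real.log_mul (by positivity) (by norm_num)]
        refine Real.log_le_log (by exact_mod_cast hmpos) ?_
        push_cast
        linarith
      · rw [if_neg hest]
        have h3 : Real.log (1 / 2) ≤ Real.log
            (((if ((w k : ℕ) : ℂ) = ((c.estimate k H y : ℕ) : ℂ) then (m k : ℝ≥0) else 0) / 2
              + 1 / 2 : ℝ≥0) : ℝ) := by
          refine Real.log_le_log (by norm_num) ?_
          push_cast
          exact le_add_of_nonneg_left (by positivity)
        rw [one_div, Real.log_inv] at h3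
        have h4 : Real.log ((m k : ℝ≥0) : ℝ) = Real.log (m k) := by simp
        linarith
  · have h1 : ∀ H, expect (obsRef N m c.q) (c.density hT H) (insert (Sum.inl k) X) (g H)
        = ∑ w : Messages m, (ENNReal.ofReal (Real.log 2) + ENNReal.ofReal (Real.log (m k)) *
          ∫⁻ z, (if c.decoded hT w H z k = w k then 0 else 1) ∂noiseLaw K N n) := by
      intro H
      refine Finset.sum_congr rfl fun w _ => ?_
      have h2 := c.lintegral_lik_error hT H w k (Finset.subset_insert (Sum.inl k) X)
        (f := fun d => ENNReal.ofReal (Real.log 2 + if d = w k then 0 else Real.log (m k)))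
      rw [h2, ← lintegral_const_mul' _ _ (by simp)]
      have h3 : ∀ z, ENNReal.ofReal
            (Real.log 2 + if c.decoded hT w H z k = w k then 0 else Real.log (m k))
          = ENNReal.ofReal (Real.log 2) + ENNReal.ofReal (Real.log (m k)) *
            if c.decoded hT w H z k = w k then 0 else 1 := by
        intro z
        split_ifs
        · simp
        · rw [ENNReal.ofReal_add hlog2 hlog, mul_one]
      simp_rw [h3]
      rw [lintegral_add_left measurable_const, lintegral_const, measure_univ, mul_one]
    have hm := c.measurable_errorProb_fading hT k
    simp_rw [h1]
    rw [lintegral_finsetSum _ fun w _ => by have := hm w; fun_prop]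
    simp_rw [fun w => lintegral_add_left (μ := fadingLaw K M N Tc n) measurable_const
      (f := fun _ => ENNReal.ofReal (Real.log 2)) (fun H => ENNReal.ofReal (Real.log (m k)) *
          ∫⁻ z, (if c.decoded hT w H z k = w k then 0 else 1) ∂noiseLaw K N n),
      fun w : Messages m => lintegral_const_mul' (μ := fadingLaw K M N Tc n)
        (ENNReal.ofReal (Real.log (m k)))
        (fun H => ∫⁻ z, (if c.decoded hT w H z k = w k then 0 else 1) ∂noiseLaw K N n)
        ENNReal.ofReal_ne_top]
    rw [Finset.sum_add_distrib, ← Finset.mul_sum, Finset.sum_const, lintegral_const, measure_univ,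
      mul_one, Finset.card_univ, nsmul_eq_mul, ENNReal.ofReal_add hlog2 (by positivity),
      ENNReal.ofReal_mul hε, mul_add]
    refine add_le_add le_rfl ?_
    calc _ ≤ ENNReal.ofReal (Real.log (m k)) * (Fintype.card (Messages m) * ENNReal.ofReal ε) := by
          gcongr
          exact (c.sum_lintegral_error_le hT k).trans (by gcongr)
      _ = _ := by ring

end Fano

end FanoBound

/-! ### Exchangeability of users and the comparison of groups in one channel use. -/

section Stages

section Symmetric

/-- For a submodular function that is invariant under exchanging single elements, the average
value per element is decreasing. -/
lemma card_mul_le_card_mul {ι : Type*} [DecidableEq ι] {F : Finset ι → ℝ} {T : Finset ι}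
    (h0 : F ∅ = 0)
    (hsub : ∀ A B i, A ⊆ B → F (insert i B) - F B ≤ F (insert i A) - F A)
    (hswap : ∀ A i j, i ∈ T → j ∈ T → i ∉ A → j ∉ A → F (insert i A) = F (insert j A))
    {S : Finset ι} (hST : S ⊆ T) : S.card * F T ≤ T.card * F S := by
  -- The increment from one more element is at most the current average: exchangeability lets the
  -- new element play the role of the last one, and submodularity makes increments decrease.
  have h1 : ∀ A ⊆ T, ∀ i ∈ T, i ∉ A → A.card * (F (insert i A) - F A) ≤ F A := by
    intro A
    induction A using Finset.induction_on with
    | empty => intro _ i _ _; simp [h0]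
    | insert a A ha ih =>
      intro hA i hi hiA
      have haT := hA (Finset.mem_insert_self a A)
      have hiA' : i ∉ A := fun h => hiA (Finset.mem_insert_of_mem h)
      have h2 := ih ((Finset.subset_insert a A).trans hA) a haT ha
      have h3 := hsub A (insert a A) i (Finset.subset_insert a A)
      rw [hswap A i a hi haT hiA' ha] at h3
      rw [Finset.card_insert_of_notMem ha]
      push_cast
      nlinarith [(A.card.cast_nonneg : (0 : ℝ) ≤ A.card)]
  suffices h : ∀ D, S ∪ D ⊆ T → S.card * F (S ∪ D) ≤ (S ∪ D).card * F S by
    have := h T (by rw [Finset.union_eq_right.2 hST])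
    rwa [Finset.union_eq_right.2 hST] at this
  intro D
  induction D using Finset.induction_on with
  | empty => simp
  | insert i D _ ih =>
    rw [Finset.union_insert]
    intro hD
    have ih' := ih ((Finset.subset_insert _ _).trans hD)
    by_cases hi : i ∈ S ∪ D
    · rwa [Finset.insert_eq_of_mem hi]
    have h2 := h1 (S ∪ D) ((Finset.subset_insert _ _).trans hD) i
      (hD (Finset.mem_insert_self _ _)) hi
    rw [Finset.card_insert_of_notMem hi]
    rcases S.eq_empty_or_nonempty with rfl | hS
    · simp [h0]
    have hc : (0 : ℝ) < (S ∪ D).card := by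
      exact_mod_cast Finset.card_pos.2 (hS.mono Finset.subset_union_left)
    have hs : (0 : ℝ) < S.card := by exact_mod_cast Finset.card_pos.2 hS
    push_cast
    refine le_of_mul_le_mul_left ?_ hc
    nlinarith

end Symmetric

variable {K M N Tc : ℕ} {γ : ℝ} {n : ℕ} {m : Fin K → ℕ} [∀ k, NeZero (m k)]
variable (c : Code K M N Tc γ n m) [∀ t, NeZero (c.q t)] (hT : 1 ≤ Tc)

section Exchange

/-- Permute the users in the channel matrices of one block. -/
def permuteBlock (β : Fin (numBlocks n Tc)) (σ : Equiv.Perm (Fin K)) (H : Fading K M N Tc n) :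
    Fading K M N Tc n :=
  fun b k => H b (if b = β then σ k else k)

lemma measurePreserving_permuteBlock (β : Fin (numBlocks n Tc)) (σ : Equiv.Perm (Fin K)) :
    MeasurePreserving (permuteBlock (M := M) (N := N) β σ) (fadingLaw K M N Tc n)
      (fadingLaw K M N Tc n) := by
  refine measurePreserving_pi _ _ (f := fun b (h : Fin K → Fin N → Fin M → ℂ) k =>
    h (if b = β then σ k else k)) fun b => ?_
  by_cases hb : b = β
  · simp only [hb, if_true]
    exact measurePreserving_pi_comp (Measure.pi fun _ => Measure.pi fun _ => complexGaussian)
      σ.injective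
  · simp only [hb, if_false]
    exact MeasurePreserving.id _

/-- Permute the users in the signals received during one block. -/
def permuteObs (hT : 1 ≤ Tc) (β : Fin (numBlocks n Tc)) (σ : Equiv.Perm (Fin K)) :
    Equiv.Perm (Obs K N n) :=
  Equiv.sumCongr (Equiv.refl _) (Equiv.sumCongr (Equiv.refl _)
    { toFun := fun x => (x.1, if blockOf hT x.1 = β then σ x.2.1 else x.2.1, x.2.2)
      invFun := fun x => (x.1, if blockOf hT x.1 = β then σ.symm x.2.1 else x.2.1, x.2.2)
      left_inv := fun x => by by_cases h : blockOf hT x.1 = β <;> simp [h]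
      right_inv := fun x => by by_cases h : blockOf hT x.1 = β <;> simp [h] })

/-- The time of an observation; messages are available from the start. -/
def obsTime : Obs K N n → ℕ
  | .inl _ => 0
  | .inr (.inl t) => t
  | .inr (.inr (t, _, _)) => t

/-- A block known at time `t'` is still known at any later time, and the block of `t` is not known
at `t`. Hence blocks known by time `t` are untouched by the permutation. -/
lemma permuteBlock_eq_of_known {t t' : Fin n} (ht : ((t.1 % Tc : ℕ) : ℝ) < γ * Tc)
    (htt : t'.1 ≤ t.1) (σ : Equiv.Perm (Fin K)) (H : Fading K M N Tc n)
    {b : Fin (numBlocks n Tc)} (hb : CSITKnown Tc γ t' b) :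
    permuteBlock (blockOf hT t) σ H b = H b := by
  have hne : b ≠ blockOf hT t := by
    rintro rfl
    have hdiv : t'.1 / Tc ≤ t.1 / Tc := Nat.div_le_div_right htt
    rcases hb with h | ⟨h, h'⟩
    · simp only [blockOf] at h
      omega
    · simp only [blockOf] at h
      have h1 := Nat.div_add_mod t.1 Tc
      have h2 := Nat.div_add_mod t'.1 Tc
      rw [h] at h1
      have h3 : t'.1 % Tc ≤ t.1 % Tc := by omega
      have h4 : ((t'.1 % Tc : ℕ) : ℝ) ≤ ((t.1 % Tc : ℕ) : ℝ) := by exact_mod_cast h3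
      linarith
  funext k
  simp [permuteBlock, hne]

/-- Before the transmitter learns the channel of the current block, the users are
exchangeable in that block. -/
lemma Code.ent_map_permuteObs {t : Fin n} (ht : ((t.1 % Tc : ℕ) : ℝ) < γ * Tc)
    (σ : Equiv.Perm (Fin K)) {X : Finset (Obs K N n)} (hX : ∀ j ∈ X, obsTime j ≤ t.1) :
    c.ent hT X = c.ent hT (X.map (permuteObs hT (blockOf hT t) σ).toEmbedding) := by
  have hx : ∀ (t' : Fin n) w H, t'.1 ≤ t.1 →
      c.x t' w (permuteBlock (blockOf hT t) σ H) = c.x t' w H := fun t' w H h =>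
    c.causal_x _ _ _ _ fun b hb => permuteBlock_eq_of_known hT ht h σ H hb
  have hy : ∀ (t' : Fin n) w H, t'.1 ≤ t.1 →
      c.y₀ t' w (permuteBlock (blockOf hT t) σ H) = c.y₀ t' w H := fun t' w H h =>
    c.causal_y₀ _ _ _ _ fun b hb => permuteBlock_eq_of_known hT ht h σ H hb
  unfold Code.ent
  congr 2
  -- Permuting the users of the block preserves the fading law. By causality the inputs stay fixed,
  -- so the permutation only relabels the received samples of that block.
  rw [← (measurePreserving_permuteBlock (blockOf hT t) σ).lintegral_comp (c.measurable_equivoc hT X)]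
  refine lintegral_congr fun H => equivoc_map _ ?_ (c.measurable_density hT _) ?_
  · rintro (k | s | ⟨s, k, i⟩) <;> rfl
  · rintro w (k | s | ⟨s, k, i⟩) hj
    · rfl
    · have := hX _ hj
      simp only [permuteObs, Equiv.sumCongr_apply, Sum.map_inr, Sum.map_inl, Equiv.refl_apply,
        Code.density]
      rw [hy s w H this]
    · have := hX _ hj
      simp only [permuteObs, Equiv.sumCongr_apply, Sum.map_inr, Equiv.coe_fn_mk,
        Code.density, Code.mean]
      rw [hx s w H this]
      rfl

end Exchange

section Stage

/-- The times before `s`. -/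
def before (n s : ℕ) : Finset (Fin n) := Finset.univ.filter fun t => t.1 < s

@[simp] lemma mem_before {s : ℕ} {t : Fin n} : t ∈ before n s ↔ t.1 < s := by simp [before]

/-- The messages of the users in `U`, and everything that the users in `A` receive before `s`. -/
def pastObs (N n : ℕ) (U A : Finset (Fin K)) (s : ℕ) : Finset (Obs K N n) :=
  msgObs N n U ∪ multicastObs K N (before n s) ∪ receivedObs N A (before n s)

@[simp] lemma inl_mem_msgObs {U : Finset (Fin K)} {k : Fin K} :
    Sum.inl k ∈ msgObs N n U ↔ k ∈ U := by simp [msgObs]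

@[simp] lemma inr_mem_msgObs {U : Finset (Fin K)} {x : Fin n ⊕ (Fin n × Fin K × Fin N)} :
    Sum.inr x ∉ msgObs N n U := by simp [msgObs]

@[simp] lemma multicast_mem_receivedObs {A : Finset (Fin K)} {τ : Finset (Fin n)} {t : Fin n} :
    Sum.inr (Sum.inl t) ∉ receivedObs N A τ := by simp [receivedObs]

@[simp] lemma received_mem_multicastObs {τ : Finset (Fin n)} {x : Fin n × Fin K × Fin N} :
    Sum.inr (Sum.inr x) ∉ multicastObs K N τ := by simp [multicastObs]

lemma pastObs_zero (U A : Finset (Fin K)) : pastObs N n U A 0 = msgObs N n U := by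
  ext (k | t | ⟨t, k, i⟩) <;> simp [pastObs]

lemma pastObs_succ (U A : Finset (Fin K)) (t : Fin n) :
    pastObs N n U A (t.1 + 1)
      = (pastObs N n U A t.1 ∪ multicastObs K N {t}) ∪ receivedObs N A {t} := by
  ext (k | s | ⟨s, k, i⟩) <;> simp [pastObs, Fin.ext_iff] <;> grind

lemma pastObs_mono (U : Finset (Fin K)) {A B : Finset (Fin K)} (hAB : A ⊆ B) (s : ℕ) :
    pastObs N n U A s ⊆ pastObs N n U B s := by
  rintro (k | t | ⟨t, k, i⟩) <;> simp [pastObs] <;> grind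

lemma receivedObs_union (A B : Finset (Fin K)) (τ : Finset (Fin n)) :
    receivedObs N (A ∪ B) τ = receivedObs N A τ ∪ receivedObs N B τ := by
  ext (k | s | ⟨s, k, i⟩) <;> simp <;> grind

/-- Conditionally on the past of T and the multicast symbol, the information from a group's samples
is a submodular set function, symmetric on T as long as the block is unknown; `card_mul_le_card_mul`
then applies. -/
lemma Code.ent_sub_received_delayed {t : Fin n} (ht : ((t.1 % Tc : ℕ) : ℝ) < γ * Tc)
    (U : Finset (Fin K)) {S T : Finset (Fin K)} (hST : S ⊆ T) :
    S.card * (c.ent hT (pastObs N n U T t.1 ∪ multicastObs K N {t})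
        - c.ent hT (pastObs N n U T t.1 ∪ multicastObs K N {t} ∪ receivedObs N T {t}))
      ≤ T.card * (c.ent hT (pastObs N n U T t.1 ∪ multicastObs K N {t})
        - c.ent hT (pastObs N n U T t.1 ∪ multicastObs K N {t} ∪ receivedObs N S {t})) := by
  refine card_mul_le_card_mul (F := fun A =>
    c.ent hT (pastObs N n U T t.1 ∪ multicastObs K N {t})
        - c.ent hT (pastObs N n U T t.1 ∪ multicastObs K N {t} ∪ receivedObs N A {t})) ?_ ?_ ?_ hST
  · have : receivedObs N (∅ : Finset (Fin K)) {t} = ∅ := by simp [receivedObs]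
    simp [this]
  · intro A B i hAB
    have h : ∀ C : Finset (Fin K), receivedObs N (insert i C) {t}
        = receivedObs N C {t} ∪ receivedObs N {i} {t} := fun C => by
      rw [← receivedObs_union, Finset.insert_eq, Finset.union_comm]
    have hmono : receivedObs N A {t} ⊆ receivedObs N B {t} := by
      rw [← Finset.union_eq_right.2 hAB, receivedObs_union]
      exact Finset.subset_union_left
    have := c.ent_submod hT (Finset.union_subset_union_right hmono
      (s := pastObs N n U T t.1 ∪ multicastObs K N {t})) (receivedObs N {i} {t})
    simp only [h, ← Finset.union_assoc]
    linarith
  · intro A i j hi hj hiA hjA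
    -- The swap also acts on earlier samples of the current block. The past of T is stable because
    -- both `i` and `j` lie in T, which is why the conditioning uses all of T.
    rw [c.ent_map_permuteObs hT ht (Equiv.swap i j)
      (X := pastObs N n U T t.1 ∪ multicastObs K N {t} ∪ receivedObs N (insert i A) {t})]
    · congr 2
      ext (k | s | ⟨s, k, a⟩)
      · simp [permuteObs, pastObs]
      · simp [permuteObs, pastObs]
      · simp only [Finset.mem_map_equiv]
        simp [permuteObs, pastObs]
        have h1 : Equiv.swap i j k ∈ T ↔ k ∈ T := by
          rw [Equiv.swap_apply_def]; split_ifs <;> simp_all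
        have h2 : Equiv.swap i j k ∈ A ↔ k ∈ A := by
          rw [Equiv.swap_apply_def]; split_ifs <;> simp_all
        have h3 : Equiv.swap i j k = i ↔ k = j := by
          rw [Equiv.swap_apply_eq_iff, Equiv.swap_apply_left]
        by_cases hs : s = t
        · subst hs; simp [h2, h3]
        · by_cases hb : blockOf hT s = blockOf hT t <;> simp [hs, hb, h1]
    · rintro (k | s | ⟨s, k, a⟩) hs
      · simp [obsTime]
      · simp [pastObs] at hs
        simp only [obsTime]
        rcases hs with hs | hs
        · exact hs.le
        · exact le_of_eq (congrArg _ hs)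
      · simp [pastObs] at hs
        simp only [obsTime]
        rcases hs with hs | hs
        · exact hs.1.le
        · exact le_of_eq (congrArg _ hs.1)

/-- Submodularity against empty conditioning: joint information is at most the sum of the individual
ones. -/
lemma Code.ent_empty_sub_le (X : Finset (Obs K N n)) :
    c.ent hT ∅ - c.ent hT X ≤ ∑ j ∈ X, (c.ent hT ∅ - c.ent hT (insert j ∅)) := by
  induction X using Finset.induction_on with
  | empty => simp
  | insert j X hj ih =>
    have := c.ent_submod_insert hT (Finset.empty_subset X) j
    rw [Finset.sum_insert hj]
    linarith

/-- The information gained in one channel use by a group of users, compared with the information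
gained by a smaller group. -/
lemma Code.ent_stage (t : Fin n) (U : Finset (Fin K)) {S T : Finset (Fin K)} (hST : S ⊆ T) {B : ℝ}
    (hB : γ * Tc ≤ ((t.1 % Tc : ℕ) : ℝ) →
      c.ent hT ∅ - c.ent hT (receivedObs N (T \ S) {t}) ≤ B) :
    S.card * (c.ent hT (pastObs N n U T t.1) - c.ent hT (pastObs N n U T (t.1 + 1)))
      ≤ T.card * (c.ent hT (pastObs N n U S t.1) - c.ent hT (pastObs N n U S (t.1 + 1)))
        + if γ * Tc ≤ ((t.1 % Tc : ℕ) : ℝ) then S.card * B else 0 := by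
  rw [pastObs_succ, pastObs_succ]
  have hcard : (S.card : ℝ) ≤ T.card := by exact_mod_cast Finset.card_le_card hST
  have hS0 : (0 : ℝ) ≤ S.card := Nat.cast_nonneg _
  have hpast := pastObs_mono (N := N) (n := n) U hST t.1
  have h1 := c.ent_submod hT hpast (multicastObs K N {t})
  have h1' := c.ent_anti hT (Finset.subset_union_left (s₁ := pastObs N n U T t.1)
    (s₂ := multicastObs K N {t}))
  have hpast' := Finset.union_subset_union_left hpast (t := multicastObs K N {t})
  have h2 := c.ent_submod hT hpast' (receivedObs N S {t})
  have h2' := c.ent_anti hT (Finset.subset_union_left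
    (s₁ := pastObs N n U T t.1 ∪ multicastObs K N {t}) (s₂ := receivedObs N S {t}))
  set PT := pastObs N n U T t.1 ∪ multicastObs K N {t} with hPT
  set PS := pastObs N n U S t.1 ∪ multicastObs K N {t} with hPS
  split_ifs with ht
  -- With the block known there is no symmetry: the extra users are charged their unconditional
  -- information, at most `B`.
  · have h3 := c.ent_submod hT (Finset.empty_subset (PT ∪ receivedObs N S {t}))
      (receivedObs N (T \ S) {t})
    rw [Finset.union_assoc PT, ← receivedObs_union, Finset.union_sdiff_of_subset hST,
      Finset.empty_union] at h3
    have h4 := hB ht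
    nlinarith
  · have h3 := c.ent_sub_received_delayed hT (not_le.1 ht) U hST
    rw [← hPT] at h3
    nlinarith

end Stage

end Stages

/-! ### Comparison over the whole transmission, and decoding. -/

section Chains

section Counting

/-- The number of channel uses in which the transmitter knows the current channel. -/
lemma sum_informed_le {Tc : ℕ} (hT : 1 ≤ Tc) {γ : ℝ} (hγ0 : 0 ≤ γ) (hγ1 : γ ≤ 1) (n : ℕ) :
    ∑ t : Fin n, (if γ * Tc ≤ ((t.1 % Tc : ℕ) : ℝ) then (1 : ℝ) else 0) ≤ (1 - γ) * n := by
  rw [Fin.sum_univ_eq_sum_range (fun t => if γ * Tc ≤ ((t % Tc : ℕ) : ℝ) then (1 : ℝ) else 0)]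
  have hbase : ∀ r ≤ Tc, ∑ t ∈ Finset.range r,
      (if γ * Tc ≤ ((t % Tc : ℕ) : ℝ) then (1 : ℝ) else 0) ≤ (1 - γ) * r := by
    intro r hr
    -- Informed channel uses come last in a block, so the count stays zero up to γ Tc and then grows
    -- by one. This sharper form carries the induction; r ≤ Tc then gives (1 - γ) r, also for an
    -- incomplete last block.
    have h1 : ∀ s ≤ r, ∑ t ∈ Finset.range s,
        (if γ * Tc ≤ ((t % Tc : ℕ) : ℝ) then (1 : ℝ) else 0) ≤ max 0 (s - γ * Tc) := by
      intro s
      induction s with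
      | zero => simp
      | succ s ih =>
        intro hs
        rw [Finset.sum_range_succ, Nat.mod_eq_of_lt (by omega)]
        have ih' := ih (by omega)
        push_cast
        split_ifs with h
        · rw [max_eq_right (by linarith)] at ih'
          exact le_max_of_le_right (by linarith)
        · rw [max_eq_left (by linarith)] at ih'
          exact le_max_of_le_left (by linarith)
    refine (h1 r le_rfl).trans (max_le (by have : (0 : ℝ) ≤ r := Nat.cast_nonneg _; nlinarith) ?_)
    have : (r : ℝ) ≤ Tc := by exact_mod_cast hr
    nlinarith
  induction n using Nat.strong_induction_on with
  | _ n ih =>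
    rcases le_total n Tc with h | h
    · exact hbase n h
    · obtain ⟨l, rfl⟩ := Nat.exists_eq_add_of_le h
      rw [Finset.sum_range_add]
      simp only [Nat.add_mod_left]
      have h1 := ih l (by omega)
      have h2 := hbase Tc le_rfl
      push_cast
      linarith

end Counting

variable {K M N Tc : ℕ} {γ : ℝ} {n : ℕ} {m : Fin K → ℕ} [∀ k, NeZero (m k)]
variable (c : Code K M N Tc γ n m) [∀ t, NeZero (c.q t)] (hT : 1 ≤ Tc)

section Chain

/-- The information that the users in `A` obtain when they know the messages of the users in `U`. -/
def Code.info (U A : Finset (Fin K)) : ℝ :=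
  c.ent hT (msgObs N n U) - c.ent hT (pastObs N n U A n)

lemma Code.info_nonneg (U A : Finset (Fin K)) : 0 ≤ c.info hT U A := by
  refine sub_nonneg.2 (c.ent_anti hT ?_)
  rintro (k | t | ⟨t, k, i⟩) <;> simp [pastObs]

lemma Code.ent_empty_sub_received_le {P : ℝ} (hP : 1 ≤ P) (t : Fin n) (ht : c.energy t ≠ ∞)
    (A : Finset (Fin K)) :
    c.ent hT ∅ - c.ent hT (receivedObs N A {t})
      ≤ A.card * N * (Real.log P + 2 + M + 2 / P * (c.energy t).toReal) := by
  refine (c.ent_empty_sub_le hT _).trans ?_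
  refine (Finset.sum_le_card_nsmul _ _ (Real.log P + 2 + M + 2 / P * (c.energy t).toReal)
    fun j hj => ?_).trans_eq ?_
  · obtain ⟨⟨s, k, i⟩, hs, rfl⟩ := Finset.mem_map.1 hj
    simp only [Finset.singleton_product, Finset.mem_map, Finset.mem_product, Finset.mem_univ] at hs
    obtain ⟨_, _, h⟩ := hs
    simp only [Function.Embedding.coeFn_mk, Prod.mk.injEq] at h ⊢
    obtain ⟨rfl, _⟩ := h
    exact c.ent_sub_received_le hT hP _ ht _ _
  · simp [receivedObs]
    ring

/-- The one-use comparisons of `Code.ent_stage` telescope over time. The power constraint bounds the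
energy terms by 2n, which with the constants 2 + M gives M + 4. -/
lemma Code.info_step (hγ0 : 0 ≤ γ) (hγ1 : γ ≤ 1) {P : ℝ} (hP : 1 ≤ P)
    (ht : ∀ t, c.energy t ≠ ∞) (hpow : ∑ t, (c.energy t).toReal ≤ n * P)
    (U : Finset (Fin K)) {S T : Finset (Fin K)} (hST : S ⊆ T) :
    S.card * c.info hT U T ≤ T.card * c.info hT U S
      + S.card * ((T.card - S.card) * N * (n * ((1 - γ) * Real.log P + M + 4))) := by
  have hP0 : 0 < P := by linarith
  have hlP : 0 ≤ Real.log P := Real.log_nonneg hP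
  let B : Fin n → ℝ := fun t =>
    (T \ S).card * N * (Real.log P + 2 + M + 2 / P * (c.energy t).toReal)
  have hB : ∀ t, 0 ≤ B t := fun t => by simp only [B]; positivity
  have h1 := Finset.sum_le_sum fun t (_ : t ∈ (Finset.univ : Finset (Fin n))) =>
    c.ent_stage hT t U hST fun _ => c.ent_empty_sub_received_le hT hP t (ht t) (T \ S)
  have htel : ∀ A : Finset (Fin K), ∑ t : Fin n,
      (c.ent hT (pastObs N n U A t.1) - c.ent hT (pastObs N n U A (t.1 + 1))) = c.info hT U A := by
    intro A
    rw [Fin.sum_univ_eq_sum_range (fun t => c.ent hT (pastObs N n U A t)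
      - c.ent hT (pastObs N n U A (t + 1))), Finset.sum_range_sub', pastObs_zero]
    rfl
  rw [Finset.sum_add_distrib, ← Finset.mul_sum, ← Finset.mul_sum, htel, htel] at h1
  refine h1.trans (add_le_add le_rfl ?_)
  -- Only the log P term must be restricted to informed uses; the bounded terms are charged to every
  -- use.
  have h2 : ∀ t : Fin n, (if γ * Tc ≤ ((t.1 % Tc : ℕ) : ℝ) then S.card * B t else 0)
      ≤ S.card * ((T \ S).card * N) * ((Real.log P) *
        (if γ * Tc ≤ ((t.1 % Tc : ℕ) : ℝ) then (1 : ℝ) else 0) + (2 + M)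
          + 2 / P * (c.energy t).toReal) := by
    intro t
    have h3 : 0 ≤ 2 / P * (c.energy t).toReal := by positivity
    split_ifs
    · simp only [B]
      rw [mul_assoc (S.card : ℝ), mul_one, add_assoc (Real.log P)]
    · positivity
  refine (Finset.sum_le_sum fun t _ => h2 t).trans ?_
  rw [← Finset.mul_sum, Finset.sum_add_distrib, Finset.sum_add_distrib, ← Finset.mul_sum,
    ← Finset.mul_sum, Finset.sum_const, Finset.card_univ, Fintype.card_fin, nsmul_eq_mul,
    Finset.card_sdiff_of_subset hST, Nat.cast_sub (Finset.card_le_card hST), mul_assoc (S.card : ℝ)]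
  have h4 : (0 : ℝ) ≤ T.card - S.card := by
    have : (S.card : ℝ) ≤ T.card := by exact_mod_cast Finset.card_le_card hST
    linarith
  gcongr
  have h5 := mul_le_mul_of_nonneg_left (sum_informed_le hT hγ0 hγ1 n) hlP
  have h6 : 2 / P * ∑ t, (c.energy t).toReal ≤ 2 * n := by
    rw [div_mul_eq_mul_div, div_le_iff₀ hP0]
    linarith
  linarith

/-- By submodularity the multicast symbols and the received samples can be bounded separately: log
of the alphabet size for the former, log P + O(1) for each of the latter. -/
lemma Code.info_empty_le {P : ℝ} (hP : 1 ≤ P) (ht : ∀ t, c.energy t ≠ ∞)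
    (hpow : ∑ t, (c.energy t).toReal ≤ n * P) (A : Finset (Fin K)) :
    c.info hT ∅ A ≤ ∑ t, Real.log (c.q t) + A.card * N * (n * (Real.log P + M + 4)) := by
  have hP0 : 0 < P := by linarith
  have h0 : pastObs N n ∅ A n
      = multicastObs K N (before n n) ∪ receivedObs N A (before n n) := by
    ext (k | t | ⟨t, k, i⟩) <;> simp [pastObs]
  have h0' : msgObs N n (∅ : Finset (Fin K)) = ∅ := by simp [msgObs]
  have hM : ∀ τ : Finset (Fin n),
      c.ent hT ∅ - c.ent hT (multicastObs K N τ) ≤ ∑ t ∈ τ, Real.log (c.q t) := by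
    intro τ
    refine (c.ent_empty_sub_le hT _).trans ?_
    rw [multicastObs, Finset.sum_map]
    exact Finset.sum_le_sum fun t _ => c.ent_sub_insert_multicast_le hT ∅ t
  have hR : ∀ τ : Finset (Fin n), c.ent hT ∅ - c.ent hT (receivedObs N A τ)
      ≤ ∑ t ∈ τ, A.card * N * (Real.log P + 2 + M + 2 / P * (c.energy t).toReal) := by
    intro τ
    induction τ using Finset.induction_on with
    | empty => simp [receivedObs]
    | insert t τ htτ ih =>
      have h1 : receivedObs N A (insert t τ) = receivedObs N A τ ∪ receivedObs N A {t} := by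
        ext (k | s | ⟨s, k, i⟩) <;> simp <;> grind
      have h2 := c.ent_submod hT (Finset.empty_subset (receivedObs N A τ)) (receivedObs N A {t})
      have h3 := c.ent_empty_sub_received_le hT hP t (ht t) A
      rw [Finset.empty_union] at h2
      rw [Finset.sum_insert htτ, h1]
      linarith
  have hb : before n n = Finset.univ := by ext; simp
  have h1 := c.ent_submod hT (Finset.empty_subset (multicastObs K N (before n n)))
    (receivedObs N A (before n n))
  have h2 := hM (before n n)
  have h3 := hR (before n n)
  rw [Code.info, h0, h0']
  rw [Finset.empty_union] at h1
  rw [hb] at h1 h2 h3 ⊢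
  rw [← Finset.mul_sum, Finset.sum_add_distrib, ← Finset.mul_sum, Finset.sum_const,
    Finset.card_univ, Fintype.card_fin, nsmul_eq_mul] at h3
  have h6 : 2 / P * ∑ t, (c.energy t).toReal ≤ 2 * n := by
    rw [div_mul_eq_mul_div, div_le_iff₀ hP0]
    linarith
  have h7 : (A.card * N : ℝ) * (n * (Real.log P + 2 + M) + 2 / P * ∑ t, (c.energy t).toReal)
      ≤ A.card * N * (n * (Real.log P + M + 4)) := by
    gcongr
    linarith
  linarith

/-- The rates of the users in `A` beyond `U` are limited by the information they obtain. -/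
lemma Code.sum_log_le_info {ε : ℝ} (hε : 0 ≤ ε) (herr : c.errorProb hT ≤ ENNReal.ofReal ε)
    {U A : Finset (Fin K)} (hUA : U ⊆ A) :
    ∑ k ∈ A \ U, Real.log (m k) ≤ c.info hT U A - c.info hT A A
      + ∑ k ∈ A \ U, (Real.log 2 + ε * Real.log (m k)) := by
  have h1 : c.ent hT (msgObs N n U) - c.ent hT (msgObs N n A) = ∑ k ∈ A \ U, Real.log (m k) := by
    rw [c.ent_msgObs, c.ent_msgObs]
    have h2 := Finset.sum_add_sum_compl U fun k => Real.log (m k : ℝ)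
    have h3 := Finset.sum_add_sum_compl A fun k => Real.log (m k : ℝ)
    have h4 := Finset.sum_sdiff hUA (f := fun k => Real.log (m k : ℝ))
    linarith
  have h2 : ∀ D ⊆ A, c.ent hT (pastObs N n U A n) - c.ent hT (pastObs N n U A n ∪ msgObs N n D)
      ≤ ∑ k ∈ D, (Real.log 2 + ε * Real.log (m k)) := by
    intro D
    induction D using Finset.induction_on with
    | empty => simp [msgObs]
    | insert k D hk ih =>
      intro hD
      have h3 : pastObs N n U A n ∪ msgObs N n (insert k D)
          = insert (Sum.inl k) (pastObs N n U A n ∪ msgObs N n D) := by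
        simp [msgObs, Finset.map_insert, Finset.union_insert]
      have h4 : multicastObs K N Finset.univ ∪ receivedObs N {k} Finset.univ
          ⊆ pastObs N n U A n ∪ msgObs N n D := by
        have := hD (Finset.mem_insert_self k D)
        rintro (l | t | ⟨t, l, i⟩) <;> simp [pastObs]
        rintro rfl
        exact this
      -- Fano's inequality conditions only on what user `k` sees; submodularity carries it to the
      -- pooled observations of all of `A`.
      have h5 := c.ent_submod_insert hT h4 (Sum.inl k)
      have h6 := c.ent_fano hT hε herr k
      have h7 := ih ((Finset.subset_insert k D).trans hD)
      rw [Finset.sum_insert hk, h3]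
      linarith
  have h3 := h2 (A \ U) Finset.sdiff_subset
  have h4 : pastObs N n U A n ∪ msgObs N n (A \ U) = pastObs N n A A n := by
    ext (k | t | ⟨t, k, i⟩)
    · simp [pastObs]
      grind
    · simp [pastObs]
    · simp [pastObs]
  rw [h4] at h3
  unfold Code.info
  linarith

end Chain

end Chains

/-! ### Weighted sums along chains of groups. -/

section Weighted

variable {K : ℕ}

/-- The sum of `f` over an increasing chain of groups of users, where each increment of the chain
is weighted by the inverse size of the group. -/
def chainSum (S : ℕ → Finset (Fin K)) (r : ℕ) (f : Fin K → ℝ) : ℝ :=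
  (∑ k ∈ S 0, f k) / (S 0).card
    + ∑ i ∈ Finset.range r, (∑ k ∈ S (i + 1) \ S i, f k) / (S (i + 1)).card

/-- The total relative growth of a chain of groups of users. -/
def chainGrowth (S : ℕ → Finset (Fin K)) (r : ℕ) : ℝ :=
  ∑ i ∈ Finset.range r, (((S (i + 1)).card : ℝ) - (S i).card) / (S (i + 1)).card

lemma chainSum_mono (S : ℕ → Finset (Fin K)) (r : ℕ) {f g : Fin K → ℝ} (h : ∀ k, f k ≤ g k) :
    chainSum S r f ≤ chainSum S r g := by
  unfold chainSum
  gcongr <;> exact h _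

lemma chainSum_mul (S : ℕ → Finset (Fin K)) (r : ℕ) (f : Fin K → ℝ) (a : ℝ) :
    chainSum S r (fun k => f k * a) = chainSum S r f * a := by
  unfold chainSum
  simp_rw [← Finset.sum_mul, mul_div_right_comm, ← Finset.sum_mul, ← add_mul]

lemma continuous_chainSum (S : ℕ → Finset (Fin K)) (r : ℕ) : Continuous (chainSum S r) := by
  unfold chainSum
  fun_prop

end Weighted

/-! ### The telescoping bound for one code. -/

section CodeBound

variable {K M N Tc : ℕ} {γ : ℝ} {n : ℕ} {m : Fin K → ℕ} [∀ k, NeZero (m k)]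
variable (c : Code K M N Tc γ n m) [∀ t, NeZero (c.q t)] (hT : 1 ≤ Tc)

/-- Enlarging the chain replaces I(S_r; S_r)/|S_r| by I(S_r; S_{r+1})/|S_{r+1}| at the price of one
growth term, and the new rates are paid out of the latter. Keeping I(S_r; S_r)/|S_r| on the left is
what makes the induction telescope. -/
lemma Code.chainSum_log_le_info (hγ0 : 0 ≤ γ) (hγ1 : γ ≤ 1) {P : ℝ} (hP : 1 ≤ P)
    (ht : ∀ t, c.energy t ≠ ∞) (hpow : ∑ t, (c.energy t).toReal ≤ n * P)
    {ε : ℝ} (hε : 0 ≤ ε) (herr : c.errorProb hT ≤ ENNReal.ofReal ε)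
    {S : ℕ → Finset (Fin K)} (hS : Monotone S) (hS0 : (S 0).Nonempty) (r : ℕ) :
    chainSum S r (fun k => Real.log (m k)) + c.info hT (S r) (S r) / (S r).card
      ≤ c.info hT ∅ (S 0) / (S 0).card
        + chainGrowth S r * (N * (n * ((1 - γ) * Real.log P + M + 4)))
        + ∑ k ∈ S r, (Real.log 2 + ε * Real.log (m k)) := by
  have hφ : ∀ k, 0 ≤ Real.log 2 + ε * Real.log (m k) := fun k => by
    have := Real.log_natCast_nonneg (m k)
    have := Real.log_nonneg one_le_two
    positivity
  have hcard : ∀ i, (1 : ℝ) ≤ (S i).card := fun i => by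
    exact_mod_cast Finset.card_pos.2 (hS0.mono (hS (Nat.zero_le i)))
  have hdiv : ∀ i, ∀ D : Finset (Fin K), (∑ k ∈ D, (Real.log 2 + ε * Real.log (m k))) / (S i).card
      ≤ ∑ k ∈ D, (Real.log 2 + ε * Real.log (m k)) := fun i D =>
    div_le_self (Finset.sum_nonneg fun k _ => hφ k) (hcard i)
  induction r with
  | zero =>
    have h1 := c.sum_log_le_info hT hε herr (Finset.empty_subset (S 0))
    rw [Finset.sdiff_empty] at h1
    have h2 := div_le_div_of_nonneg_right h1 (by linarith [hcard 0] : (0 : ℝ) ≤ (S 0).card)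
    rw [add_div, sub_div] at h2
    have h3 := hdiv 0 (S 0)
    simp only [chainSum, chainGrowth, Finset.range_zero, Finset.sum_empty]
    linarith
  | succ r ih =>
    have hsub : S r ⊆ S (r + 1) := hS (Nat.le_succ r)
    have h1 := c.sum_log_le_info hT hε herr hsub
    have h2 := div_le_div_of_nonneg_right h1 (by linarith [hcard (r + 1)] : (0 : ℝ) ≤ (S (r + 1)).card)
    rw [add_div, sub_div] at h2
    have h3 := hdiv (r + 1) (S (r + 1) \ S r)
    have h4 := c.info_step hT hγ0 hγ1 hP ht hpow (S r) hsub
    have ha : (0 : ℝ) < (S r).card := by linarith [hcard r]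
    have hb : (0 : ℝ) < (S (r + 1)).card := by linarith [hcard (r + 1)]
    have h5 : c.info hT (S r) (S (r + 1)) / (S (r + 1)).card ≤ c.info hT (S r) (S r) / (S r).card
        + (((S (r + 1)).card : ℝ) - (S r).card) / (S (r + 1)).card
          * (N * (n * ((1 - γ) * Real.log P + M + 4))) := by
      have h6 := div_le_div_of_nonneg_right h4 (mul_pos ha hb).le
      have e1 : ((S r).card * c.info hT (S r) (S (r + 1))) / ((S r).card * (S (r + 1)).card : ℝ)
          = c.info hT (S r) (S (r + 1)) / (S (r + 1)).card := by field_simp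
      rw [e1] at h6
      refine h6.trans_eq ?_
      field_simp
    have h6 := Finset.sum_sdiff hsub (f := fun k => Real.log 2 + ε * Real.log (m k))
    simp only [chainSum, chainGrowth, Finset.sum_range_succ, add_mul] at ih ⊢
    linarith

end CodeBound

/-! ### From finite codes to degrees of freedom. -/

section Rates

variable {K M N Tc : ℕ} {γ : ℝ}

lemma log_ceil_le {x : ℝ} (hx : 0 ≤ x) : Real.log (⌈(2 : ℝ) ^ x⌉₊ : ℝ) ≤ x * Real.log 2 + Real.log 2 := by
  have h1 : (1 : ℝ) ≤ 2 ^ x := Real.one_le_rpow one_le_two hx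
  have h2 : (⌈(2 : ℝ) ^ x⌉₊ : ℝ) ≤ 2 ^ x * 2 := by
    have := Nat.ceil_lt_add_one (zero_le_one.trans h1)
    linarith
  have h3 : (0 : ℝ) < ⌈(2 : ℝ) ^ x⌉₊ := by
    exact_mod_cast Nat.ceil_pos.2 (by linarith)
  refine (Real.log_le_log h3 h2).trans_eq ?_
  rw [Real.log_mul (by positivity) (by norm_num), Real.log_rpow two_pos]

lemma le_log_ceil (x : ℝ) : x * Real.log 2 ≤ Real.log (⌈(2 : ℝ) ^ x⌉₊ : ℝ) := by
  rw [← Real.log_rpow two_pos]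
  exact Real.log_le_log (by positivity) (Nat.le_ceil _)

lemma Code.energy_bounds {n : ℕ} {m : Fin K → ℕ} (c : Code K M N Tc γ n m) {P : ℝ}
    (hP : 0 ≤ P) (h : c.PowerConstraint P) :
    (∀ t, c.energy t ≠ ∞) ∧ ∑ t, (c.energy t).toReal ≤ n * P := by
  have h' : ∑ t, c.energy t ≤ ENNReal.ofReal (n * P) := h
  have hne : ∀ t, c.energy t ≠ ∞ := fun t =>
    ne_top_of_le_ne_top ENNReal.ofReal_ne_top
      ((Finset.single_le_sum (f := c.energy) (fun _ _ => zero_le) (Finset.mem_univ t)).trans h')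
  refine ⟨hne, ?_⟩
  rw [← ENNReal.toReal_sum fun t _ => hne t]
  exact ENNReal.toReal_le_of_le_ofReal (by positivity) h'

/-- The converse bound at finite power. -/
lemma Achievable.chainSum_le {hT : 1 ≤ Tc} (hγ0 : 0 ≤ γ) (hγ1 : γ ≤ 1) {P rM : ℝ} (hP : 1 ≤ P)
    {R : Fin K → ℝ} (h : Achievable K M N hT γ P rM R)
    {S : ℕ → Finset (Fin K)} (hS : Monotone S) (hS0 : (S 0).Nonempty) (r : ℕ) :
    chainSum S r R * Real.log 2 ≤ rM * Real.log 2 / (S 0).card + N * (Real.log P + M + 4)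
      + chainGrowth S r * (N * ((1 - γ) * Real.log P + M + 4)) + (2 * K + 1) := by
  obtain ⟨hR, h⟩ := h
  have hRsum : 0 ≤ ∑ k, R k := Finset.sum_nonneg fun k _ => hR k
  -- With this ε the Fano term ε n ∑ R_k is at most n. All other terms are at most linear in n, so a
  -- single n ≥ 1 suffices and no limit in n is taken.
  set ε : ℝ := 1 / (1 + ∑ k, R k) with hεdef
  have hε : 0 < ε := by positivity
  obtain ⟨n, hn, c, hpow, hmc, herr⟩ :=
    ((eventually_ge_atTop 1).and (h (ENNReal.ofReal ε) (ENNReal.ofReal_pos.2 hε))).exists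
  have hn0 : (0 : ℝ) < n := by exact_mod_cast hn
  have : ∀ k, NeZero ⌈(2 : ℝ) ^ (n * R k)⌉₊ := fun k =>
    ⟨(Nat.ceil_pos.2 (by positivity)).ne'⟩
  have : ∀ t, NeZero (c.q t) := fun t =>
    ⟨fun h0 => (Fin.cast h0 (c.y₀ t (fun _ => 0) (fun _ _ _ _ => 0))).elim0⟩
  obtain ⟨hE, hEsum⟩ := c.energy_bounds (zero_le_one.trans hP) hpow
  have h1 := c.chainSum_log_le_info hT hγ0 hγ1 hP hE hEsum hε.le herr hS hS0 r
  have h2 := c.info_empty_le hT hP hE hEsum (S 0)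
  have h3 : 0 ≤ c.info hT (S r) (S r) / (S r).card :=
    div_nonneg (c.info_nonneg hT _ _) (Nat.cast_nonneg _)
  have hS0' : (0 : ℝ) < (S 0).card := by exact_mod_cast Finset.card_pos.2 hS0
  have hl2 : 0 ≤ Real.log 2 := Real.log_nonneg one_le_two
  have hl2' : Real.log 2 ≤ 1 := by
    have := Real.log_le_sub_one_of_pos (two_pos : (0 : ℝ) < 2)
    linarith
  have hq : ∑ t, Real.log (c.q t) ≤ n * (rM * Real.log 2) := by
    rw [← Real.log_prod fun t _ => by exact_mod_cast NeZero.ne (c.q t)]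
    have h4 : ((∏ t, c.q t : ℕ) : ℝ) ≤ (2 : ℝ) ^ (n * rM) := hmc
    have h5 : (0 : ℝ) < ((∏ t, c.q t : ℕ) : ℝ) := by
      exact_mod_cast Finset.prod_pos fun t _ => Nat.pos_of_ne_zero (NeZero.ne (c.q t))
    have h6 := Real.log_le_log h5 h4
    rw [Real.log_rpow two_pos] at h6
    push_cast at h6
    linarith
  have hφ : ∑ k ∈ S r, (Real.log 2 + ε * Real.log (⌈(2 : ℝ) ^ (n * R k)⌉₊ : ℝ))
      ≤ n * (2 * K + 1) := by
    have hεR : ε * ∑ k, R k ≤ 1 := by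
      rw [hεdef, div_mul_eq_mul_div, one_mul, div_le_one (by positivity)]
      linarith
    have hε1 : ε ≤ 1 := by
      rw [hεdef, div_le_one (by positivity)]
      linarith
    calc ∑ k ∈ S r, (Real.log 2 + ε * Real.log (⌈(2 : ℝ) ^ (n * R k)⌉₊ : ℝ))
        ≤ ∑ k, (Real.log 2 + ε * Real.log (⌈(2 : ℝ) ^ (n * R k)⌉₊ : ℝ)) := by
          refine Finset.sum_le_sum_of_subset_of_nonneg (Finset.subset_univ _) fun k _ _ => ?_
          have := Real.log_natCast_nonneg ⌈(2 : ℝ) ^ (n * R k)⌉₊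
          positivity
      -- Per user, one unit covers log 2 and another covers the rounding of the message count, as ε
      -- ≤ 1.
      _ ≤ ∑ k, (2 + ε * R k * n) := by
          refine Finset.sum_le_sum fun k _ => ?_
          have h4 := log_ceil_le (mul_nonneg hn0.le (hR k))
          have h5 : n * R k * Real.log 2 ≤ n * R k :=
            mul_le_of_le_one_right (mul_nonneg hn0.le (hR k)) hl2'
          have h6 : ε * Real.log (⌈(2 : ℝ) ^ (n * R k)⌉₊ : ℝ) ≤ ε * (n * R k + 1) := by
            gcongr
            linarith
          linarith
      _ = 2 * K + ε * (∑ k, R k) * n := by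
          rw [Finset.sum_add_distrib, ← Finset.sum_mul, ← Finset.mul_sum]
          simp
          ring
      _ ≤ n * (2 * K + 1) := by
          have hn1 : (1 : ℝ) ≤ n := by exact_mod_cast hn
          have : (0 : ℝ) ≤ K := Nat.cast_nonneg K
          nlinarith
  have h4 : n * (chainSum S r R * Real.log 2)
      ≤ chainSum S r fun k => Real.log (⌈(2 : ℝ) ^ (n * R k)⌉₊ : ℝ) := by
    rw [mul_comm, mul_assoc, ← chainSum_mul]
    exact chainSum_mono S r fun k => 
      (by ring : R k * (Real.log 2 * n) = n * R k * Real.log 2).trans_le (le_log_ceil _)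
  have h5 : c.info hT ∅ (S 0) / (S 0).card
      ≤ n * (rM * Real.log 2 / (S 0).card + N * (Real.log P + M + 4)) := by
    rw [div_le_iff₀ hS0']
    have : n * (rM * Real.log 2 / (S 0).card + N * (Real.log P + M + 4)) * (S 0).card
        = n * (rM * Real.log 2) + (S 0).card * N * (n * (Real.log P + M + 4)) := by
      field_simp
    linarith
  refine le_of_mul_le_mul_left ?_ hn0
  linarith

/-- The DoF region is contained in a half-space for every chain of groups of users. -/
lemma chainSum_le_of_mem_dofRegion {hT : 1 ≤ Tc} (hγ0 : 0 ≤ γ) (hγ1 : γ ≤ 1) {dM : ℝ}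
    {d : Fin K → ℝ} (hd : d ∈ dofRegion K M N hT γ dM)
    {S : ℕ → Finset (Fin K)} (hS : Monotone S) (hS0 : (S 0).Nonempty) (r : ℕ) :
    chainSum S r d ≤ dM / (S 0).card + N + chainGrowth S r * (N * (1 - γ)) := by
  obtain ⟨R, hA, hlim⟩ := hd
  set A : ℝ := dM / (S 0).card + N + chainGrowth S r * (N * (1 - γ)) with hAdef
  set C : ℝ := N * (M + 4) + chainGrowth S r * (N * (M + 4)) + (2 * K + 1) with hC
  have h1 : Tendsto (fun P => chainSum S r fun k => R P k / Real.logb 2 P) atTop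
      (𝓝 (chainSum S r d)) :=
    ((continuous_chainSum S r).tendsto d).comp (tendsto_pi_nhds.2 hlim)
  have h2 : Tendsto (fun P => A + C / Real.log P) atTop (𝓝 (A + 0)) :=
    tendsto_const_nhds.add (Real.tendsto_log_atTop.const_div_atTop C)
  rw [add_zero] at h2
  refine le_of_tendsto_of_tendsto h1 h2 ?_
  filter_upwards [hA, eventually_gt_atTop 1] with P hP hP1
  have h3 := hP.chainSum_le hγ0 hγ1 hP1.le hS hS0 r
  have hl : 0 < Real.log P := Real.log_pos hP1
  have hl2 : 0 < Real.log 2 := Real.log_pos one_lt_two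
  have h4 : (chainSum S r fun k => R P k / Real.logb 2 P)
      = chainSum S r (R P) * Real.log 2 / Real.log P := by
    simp_rw [Real.logb, div_div_eq_mul_div, mul_div_assoc]
    rw [chainSum_mul]
  have h5 : dM * Real.logb 2 P * Real.log 2 = dM * Real.log P := by
    rw [mul_assoc, Real.logb, div_mul_cancel₀ _ hl2.ne']
  rw [h4, div_le_iff₀ hl, add_mul, div_mul_cancel₀ _ hl.ne']
  rw [h5] at h3
  have h6 : A * Real.log P = dM * Real.log P / (S 0).card + N * Real.log P
      + chainGrowth S r * (N * (1 - γ)) * Real.log P := by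
    rw [hAdef]; ring
  rw [h6, hC]
  linarith

end Rates

/-! ### Symmetrisation over cyclic shifts of the users. -/

section Averaging

variable {K M N Tc : ℕ} {γ : ℝ}

/-- The first `b` users in the cyclic order starting at user `j`. -/
def cyclicGroup (K : ℕ) [NeZero K] (b : ℕ) (j : Fin K) : Finset (Fin K) :=
  (Finset.univ.filter fun k : Fin K => k.1 < b).map (Equiv.addRight j).toEmbedding

lemma card_cyclicGroup [NeZero K] {b : ℕ} (hb : b ≤ K) (j : Fin K) :
    (cyclicGroup K b j).card = b := by
  rw [cyclicGroup, Finset.card_map, Fin.card_filter_val_lt, min_eq_right hb]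

lemma cyclicGroup_mono [NeZero K] {a b : ℕ} (hab : a ≤ b) (j : Fin K) :
    cyclicGroup K a j ⊆ cyclicGroup K b j := by
  unfold cyclicGroup
  refine Finset.map_subset_map.2 fun k hk => ?_
  simp only [Finset.mem_filter, Finset.mem_univ, true_and] at hk ⊢
  omega

/-- Each user lies in exactly `b` of the K shifted groups. -/
lemma sum_sum_cyclicGroup [NeZero K] {b : ℕ} (hb : b ≤ K) (d : Fin K → ℝ) :
    ∑ j, ∑ k ∈ cyclicGroup K b j, d k = b * ∑ k, d k := by
  simp only [cyclicGroup, Finset.sum_map, Equiv.coe_toEmbedding, Equiv.coe_addRight]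
  rw [Finset.sum_comm]
  have : ∀ k : Fin K, ∑ j, d (k + j) = ∑ k, d k := fun k =>
    Fintype.sum_equiv (Equiv.addLeft k) _ _ fun j => rfl
  simp_rw [this]
  rw [Finset.sum_const, Fin.card_filter_val_lt, min_eq_right hb, nsmul_eq_mul]

/-- The bound on the sum DoF that results from averaging over the cyclic order of the users. -/
lemma sum_le_of_mem_dofRegion {hT : 1 ≤ Tc} (hγ0 : 0 ≤ γ) (hγ1 : γ ≤ 1) {dM : ℝ}
    {d : Fin K → ℝ} (hd : d ∈ dofRegion K M N hT γ dM)
    {b : ℕ → ℕ} (hb : Monotone b) (hb0 : 1 ≤ b 0) (hbK : ∀ i, b i ≤ K) (r : ℕ) :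
    (1 + ∑ i ∈ Finset.range r, ((b (i + 1) : ℝ) - b i) / b (i + 1)) * ∑ k, d k
      ≤ K * (dM / b 0 + N
        + (∑ i ∈ Finset.range r, ((b (i + 1) : ℝ) - b i) / b (i + 1)) * (N * (1 - γ))) := by
  have hK : NeZero K := ⟨by have := hbK 0; omega⟩
  have hpos : ∀ i, (0 : ℝ) < b i := fun i => by
    exact_mod_cast lt_of_lt_of_le hb0 (hb (Nat.zero_le i))
  have h1 : ∀ j : Fin K, chainSum (fun i => cyclicGroup K (b i) j) r d
      ≤ dM / b 0 + N
        + (∑ i ∈ Finset.range r, ((b (i + 1) : ℝ) - b i) / b (i + 1)) * (N * (1 - γ)) := by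
    intro j
    have := chainSum_le_of_mem_dofRegion hγ0 hγ1 hd
      (S := fun i => cyclicGroup K (b i) j) (fun a b hab => cyclicGroup_mono (hb hab) j)
      (Finset.card_pos.1 (by rw [card_cyclicGroup (hbK 0)]; omega)) r
    simpa only [chainGrowth, card_cyclicGroup (hbK _)] using this
  have h2 := Finset.sum_le_sum fun j (_ : j ∈ (Finset.univ : Finset (Fin K))) => h1 j
  rw [Finset.sum_const, Finset.card_univ, Fintype.card_fin, nsmul_eq_mul] at h2
  refine le_of_eq_of_le ?_ h2
  simp only [chainSum, card_cyclicGroup (hbK _)]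
  have h3 : ∀ i (j : Fin K), ∑ k ∈ cyclicGroup K (b (i + 1)) j \ cyclicGroup K (b i) j, d k
      = ∑ k ∈ cyclicGroup K (b (i + 1)) j, d k - ∑ k ∈ cyclicGroup K (b i) j, d k := fun i j =>
    Finset.sum_sdiff_eq_sub (cyclicGroup_mono (hb (Nat.le_succ i)) j)
  simp_rw [h3]
  rw [Finset.sum_add_distrib, Finset.sum_comm, ← Finset.sum_div, sum_sum_cyclicGroup (hbK 0),
    mul_div_cancel_left₀ _ (hpos 0).ne', add_mul, one_mul, Finset.sum_mul]
  congr 1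
  refine Finset.sum_congr rfl fun i _ => ?_
  rw [← Finset.sum_div, Finset.sum_sub_distrib, sum_sum_cyclicGroup (hbK _),
    sum_sum_cyclicGroup (hbK _)]
  ring

end Averaging

/-! ### The two chains, and comparison of the closed forms. -/

section Bounds

variable {K M N Tc : ℕ} {γ dM : ℝ}

/-- The two-step chain of sizes L and K, with growth (K - L)/K; clearing denominators by KL gives
the closed form. -/
lemma sum_le_fp {hT : 1 ≤ Tc} (hγ0 : 0 ≤ γ) (hγ1 : γ ≤ 1) {d : Fin K → ℝ}
    (hd : d ∈ dofRegion K M N hT γ dM) {L : ℕ} (hL : 1 ≤ L) (hLK : L ≤ K) :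
    ∑ k, d k ≤ fp K N γ L dM := by
  have h := sum_le_of_mem_dofRegion hγ0 hγ1 hd (b := fun i => if i = 0 then L else K)
    (fun i j hij => by dsimp only; split_ifs <;> omega) (by simpa using hL)
    (fun i => by split_ifs <;> omega) 1
  simp only [Finset.sum_range_one, zero_add, one_ne_zero, if_true, if_false] at h
  have hL0 : (0 : ℝ) < L := by exact_mod_cast hL
  have hK0 : (0 : ℝ) < K := by exact_mod_cast hL.trans hLK
  have hLK' : (L : ℝ) ≤ K := by exact_mod_cast hLK
  have hden : (0 : ℝ) < K * L + L * (K - L) := by nlinarith [mul_pos hK0 hL0]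
  rw [fp, le_div_iff₀ hden]
  have h2 := mul_le_mul_of_nonneg_left h (mul_pos hK0 hL0).le
  have e1 : (K * L : ℝ) * ((1 + ((K : ℝ) - L) / K) * ∑ k, d k)
      = (∑ k, d k) * (K * L + L * (K - L)) := by
    field_simp
  have e2 : (K * L : ℝ) * (K * (dM / L + N + ((K : ℝ) - L) / K * (N * (1 - γ))))
      = (K : ℝ) ^ 2 * dM + (K : ℝ) ^ 2 * N * L + (K : ℝ) * N * L * ((K : ℝ) - L) * (1 - γ) := by
    field_simp
  linarith

lemma sum_Icc_inv_eq (K : ℕ) (hK : 1 ≤ K) :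
    ∑ k ∈ Finset.Icc 1 K, 1 / (k : ℝ) = 1 + ∑ i ∈ Finset.range (K - 1), 1 / ((i : ℝ) + 2) := by
  obtain ⟨l, rfl⟩ := Nat.exists_eq_add_of_le' hK
  rw [Nat.add_sub_cancel]
  induction l with
  | zero => simp
  | succ l ih =>
    rw [Finset.sum_Icc_succ_top (by omega), ih (by omega), Finset.sum_range_succ, add_assoc]
    push_cast
    ring_nf

lemma fa_one_eq (hK : 1 ≤ K) : fa K N γ 1 dM
    = ((K : ℝ) * dM + (K : ℝ) * N * γ) / (∑ k ∈ Finset.Icc 1 K, 1 / (k : ℝ))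
      + (K : ℝ) * N * (1 - γ) := by
  obtain ⟨l, rfl⟩ := Nat.exists_eq_add_of_le' hK
  have hS : ∑ k ∈ Finset.Icc 1 (l + 1), 1 / (k : ℝ)
      = ∑ k ∈ Finset.Icc 1 l, 1 / (k : ℝ) + 1 / ((l : ℝ) + 1) := by
    rw [Finset.sum_Icc_succ_top (by omega)]
    push_cast
    rfl
  have h0 : 0 ≤ ∑ k ∈ Finset.Icc 1 l, 1 / (k : ℝ) := Finset.sum_nonneg fun _ _ => by positivity
  rw [fa, hS, Nat.add_sub_cancel]
  push_cast
  set s := ∑ k ∈ Finset.Icc 1 l, 1 / (k : ℝ)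
  congr 1
  rw [div_eq_div_iff]
  · field_simp
    ring
  · have : (0 : ℝ) ≤ l := Nat.cast_nonneg l
    have h1 : ((l : ℝ) + 1 - 1 + 2) * 1 + ((l : ℝ) + 1 + 1) * ((l : ℝ) + 1 - 1 + 1) * s
      = (l + 2) * (1 + (l + 1) * s) := by ring
    rw [h1]
    positivity
  · positivity

/-- The finest chain, adding one user at a time, has growth 1/2 + … + 1/K, the harmonic sum minus
one. -/
lemma sum_le_fa {hT : 1 ≤ Tc} (hγ0 : 0 ≤ γ) (hγ1 : γ ≤ 1) {d : Fin K → ℝ}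
    (hd : d ∈ dofRegion K M N hT γ dM) (hK : 1 ≤ K) :
    ∑ k, d k ≤ fa K N γ 1 dM := by
  -- The sizes are capped at K only to be valid for every index; the first K - 1 steps stay below
  -- the cap.
  have h := sum_le_of_mem_dofRegion hγ0 hγ1 hd (b := fun i => min (i + 1) K)
    (fun i j hij => by dsimp only; omega) (by simpa using hK) (fun i => min_le_right _ _) (K - 1)
  have hσ : ∑ i ∈ Finset.range (K - 1),
      (((min (i + 1 + 1) K : ℕ) : ℝ) - (min (i + 1) K : ℕ)) / (min (i + 1 + 1) K : ℕ)
      = ∑ k ∈ Finset.Icc 1 K, 1 / (k : ℝ) - 1 := by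
    rw [sum_Icc_inv_eq K hK, add_sub_cancel_left]
    refine Finset.sum_congr rfl fun i hi => ?_
    have := Finset.mem_range.1 hi
    rw [min_eq_left (by omega), min_eq_left (by omega)]
    push_cast
    congr 1 <;> ring
  have hb0 : ((min (0 + 1) K : ℕ) : ℝ) = 1 := by
    rw [min_eq_left (by omega)]; simp
  rw [hσ, hb0] at h
  have hpos : 0 < ∑ k ∈ Finset.Icc 1 K, 1 / (k : ℝ) :=
    Finset.sum_pos (fun k hk => by
      have : 1 ≤ k := (Finset.mem_Icc.1 hk).1
      positivity) ⟨1, Finset.mem_Icc.2 ⟨le_rfl, hK⟩⟩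
  rw [fa_one_eq hK]
  set s := ∑ k ∈ Finset.Icc 1 K, 1 / (k : ℝ)
  have e : ((K : ℝ) * dM + K * N * γ) / s + K * N * (1 - γ)
      = (K * (dM / 1 + N + (s - 1) * (N * (1 - γ)))) / s := by
    field_simp
    ring
  rw [e, le_div_iff₀ hpos]
  linarith

lemma sumDoF_le {hT : 1 ≤ Tc} (hγ0 : 0 ≤ γ) (hγ1 : γ ≤ 1) {L : ℕ} (hL : 1 ≤ L) (hLK : L ≤ K) :
    sumDoF K M N hT γ dM ≤ ((min (fp K N γ L dM) (fa K N γ 1 dM) : ℝ) : EReal) := by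
  refine sSup_le ?_
  rintro _ ⟨d, hd, rfl⟩
  exact EReal.coe_le_coe_iff.2
    (le_min (sum_le_fp hγ0 hγ1 hd hL hLK) (sum_le_fa hγ0 hγ1 hd (hL.trans hLK)))

lemma fp_self (hK : 1 ≤ K) : fp K N γ K dM = (K : ℝ) * N + dM := by
  have : (0 : ℝ) < K := by exact_mod_cast hK
  rw [fp]
  field_simp
  ring

lemma fq_self : fq K N γ K = (K : ℝ) * ((K : ℝ) - 1) * N * γ := by
  rw [fq]
  ring_nf

lemma harmonic_le (hK : 2 ≤ K) :
    ∑ k ∈ Finset.Icc 1 K, 1 / (k : ℝ) ≤ K - 1 + 1 / K := by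
  obtain ⟨l, rfl⟩ := Nat.exists_eq_add_of_le' (by omega : 1 ≤ K)
  rw [Finset.sum_Icc_succ_top (by omega)]
  have h : ∑ k ∈ Finset.Icc 1 l, 1 / (k : ℝ) ≤ l := by
    refine (Finset.sum_le_card_nsmul _ _ 1 fun k hk => ?_).trans_eq (by simp)
    have : (1 : ℝ) ≤ k := by exact_mod_cast (Finset.mem_Icc.1 hk).1
    exact (div_le_one (by positivity)).2 this
  push_cast
  linarith

lemma le_harmonic (hK : 1 ≤ K) :
    (2 * (K : ℝ) - 1) / K ≤ ∑ k ∈ Finset.Icc 1 K, 1 / (k : ℝ) := by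
  have hK0 : (0 : ℝ) < K := by exact_mod_cast hK
  rw [sum_Icc_inv_eq K hK]
  have h : ∑ _i ∈ Finset.range (K - 1), 1 / (K : ℝ)
      ≤ ∑ i ∈ Finset.range (K - 1), 1 / ((i : ℝ) + 2) := by
    refine Finset.sum_le_sum fun i hi => ?_
    have h1 : i + 2 ≤ K := by have := Finset.mem_range.1 hi; omega
    have h2 : (i : ℝ) + 2 ≤ K := by exact_mod_cast h1
    gcongr
  rw [Finset.sum_const, Finset.card_range, nsmul_eq_mul, Nat.cast_sub hK] at h
  have : (2 * (K : ℝ) - 1) / K = 1 + ((K : ℝ) - (1 : ℕ)) * (1 / K) := by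
    push_cast
    field_simp
    ring
  linarith

/-- With s the harmonic sum, the claim is K N γ (s - 1) ≤ (K - s) dM. At the threshold dM = K(K -
1)Nγ it follows from s ≤ K - 1 + 1/K, which is `harmonic_le`. -/
lemma fp_self_le_fa (hK : 2 ≤ K) (hγ0 : 0 ≤ γ) (h : fq K N γ K ≤ dM) :
    fp K N γ K dM ≤ fa K N γ 1 dM := by
  rw [fq_self] at h
  rw [fp_self (by omega), fa_one_eq (by omega)]
  have hK2 : (2 : ℝ) ≤ K := by exact_mod_cast hK
  have hle := harmonic_le hK
  have hpos : 0 < ∑ k ∈ Finset.Icc 1 K, 1 / (k : ℝ) :=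
    lt_of_lt_of_le (div_pos (by linarith) (by linarith)) (le_harmonic (by omega : 1 ≤ K))
  set s := ∑ k ∈ Finset.Icc 1 K, 1 / (k : ℝ)
  rw [← sub_le_iff_le_add, le_div_iff₀ hpos]
  have hN : (0 : ℝ) ≤ N * γ := by positivity
  have h1 : 1 / (K : ℝ) ≤ 1 := by rw [div_le_one] <;> linarith
  have h2 : 0 ≤ (K : ℝ) - s := by linarith
  have h3 := mul_le_mul_of_nonneg_left h h2
  have h4 : (K : ℝ) * s ≤ K * (K - 1) + 1 := by
    have := mul_le_mul_of_nonneg_left hle (by linarith : (0 : ℝ) ≤ K)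
    rw [mul_add, mul_one_div_cancel (by linarith)] at this
    exact this
  have h5 : (K : ℝ) * (N * γ) * (s - 1) ≤ K * (N * γ) * ((K - s) * (K - 1)) := by
    refine mul_le_mul_of_nonneg_left ?_ (by positivity)
    nlinarith
  nlinarith

/-- The bound `fp` at L = 1 is the formula for `fa` with the harmonic sum replaced by its lower
bound (2K - 1)/K. -/
lemma fa_le_fp_one (hK : 1 ≤ K) (h : 0 ≤ dM) (hγ0 : 0 ≤ γ) :
    fa K N γ 1 dM ≤ fp K N γ 1 dM := by
  rw [fa_one_eq hK, fp]
  have hK0 : (1 : ℝ) ≤ K := by exact_mod_cast hK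
  have hle := le_harmonic hK
  have hpos : 0 < (2 * (K : ℝ) - 1) / K := div_pos (by linarith) (by linarith)
  have h1 : ((K : ℝ) * dM + K * N * γ) / (∑ k ∈ Finset.Icc 1 K, 1 / (k : ℝ))
      ≤ (K * dM + K * N * γ) / ((2 * (K : ℝ) - 1) / K) := by
    gcongr
  have hne : 2 * (K : ℝ) - 1 ≠ 0 := by linarith
  have h2 : ((K : ℝ) * dM + K * N * γ) / ((2 * (K : ℝ) - 1) / K) + K * N * (1 - γ)
      = ((K : ℝ) ^ 2 * dM + (K : ℝ) ^ 2 * N * (1 : ℕ)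
        + (K : ℝ) * N * (1 : ℕ) * ((K : ℝ) - (1 : ℕ)) * (1 - γ))
        / ((K : ℝ) * (1 : ℕ) + (1 : ℕ) * ((K : ℝ) - (1 : ℕ))) := by
    have e : (K : ℝ) * (1 : ℕ) + (1 : ℕ) * ((K : ℝ) - (1 : ℕ)) = 2 * K - 1 := by push_cast; ring
    rw [e, div_div_eq_mul_div, div_add' _ _ _ hne]
    push_cast
    congr 1
    ring
  linarith

end Bounds

end

end MimoBC

theorem mainTheorem4 (K M N Tc : ℕ) (γ dM : ℝ) (hK : 2 ≤ K) (hN : 1 ≤ N) (hM : K * N ≤ M)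
    (hT : 1 ≤ Tc) (hγ0 : 0 ≤ γ) (hγ1 : γ ≤ 1) :
    (MimoBC.fq K N γ K ≤ dM →
      MimoBC.sumDoF K M N hT γ dM
          ≤ ((min (MimoBC.fp K N γ K dM) (MimoBC.fa K N γ 1 dM) : ℝ) : EReal) ∧
        min (MimoBC.fp K N γ K dM) (MimoBC.fa K N γ 1 dM) = MimoBC.fp K N γ K dM ∧
        MimoBC.fp K N γ K dM = (K : ℝ) * N + dM) ∧
    (∀ L : ℕ, 1 ≤ L → L ≤ K - 1 → MimoBC.fq K N γ L ≤ dM → dM ≤ MimoBC.fq K N γ (L + 1) →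
      MimoBC.sumDoF K M N hT γ dM
        ≤ ((min (MimoBC.fp K N γ L dM) (MimoBC.fa K N γ 1 dM) : ℝ) : EReal)) ∧
    (MimoBC.fq K N γ 1 ≤ dM →
      min (MimoBC.fp K N γ 1 dM) (MimoBC.fa K N γ 1 dM) = MimoBC.fa K N γ 1 dM ∧
        MimoBC.fa K N γ 1 dM
          = ((K : ℝ) * dM + (K : ℝ) * N * γ) / (∑ k ∈ Finset.Icc 1 K, 1 / (k : ℝ))
            + (K : ℝ) * N * (1 - γ)) ∧
    MimoBC.fq K N γ K = (K : ℝ) * ((K : ℝ) - 1) * N * γ := by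
  refine ⟨fun h => ⟨MimoBC.sumDoF_le hγ0 hγ1 (by omega) le_rfl,
    min_eq_left (MimoBC.fp_self_le_fa hK hγ0 h), MimoBC.fp_self (by omega)⟩,
    fun L hL hLK _ _ => MimoBC.sumDoF_le hγ0 hγ1 hL (by omega),
    fun h => ⟨min_eq_right (MimoBC.fa_le_fp_one (by omega) ?_ hγ0), MimoBC.fa_one_eq (by omega)⟩,
    MimoBC.fq_self⟩
  simpa [MimoBC.fq] using h
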